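/- **Setting.** Let $(\Omega,\Upsilon,P)$ be a probability space, $(\mathcal X,\mathcal A)$ a measurable space, $X_{i,n}:\Omega\to\mathcal X$ ($1\le i\le n$, $n\in\mathbb N$) random variables, and $\mathcal F$ a set of measurable functions $\mathcal X\to\mathbb R$ having a finite measurable envelope $F$, i.e. $|f(x)|\le F(x)<\infty$ for all $f\in\mathcal F$, $x\in\mathcal X$, with $E[F(X_{i,n})]<\infty$ for all $1\le i\le n$. For $\Psi\ne\emptyset$ let $\ell^\infty(\Psi)$ be the space of bounded functions $\Psi\to\mathbb R$ with the supremum norm and its Borel $\sigma$-field. The sequential empirical process is the (possibly nonmeasurable) map $\mathbb Z_n:\Omega\to\ell^\infty([0,1]\times\mathcal F)$, $$\mathbb Z_n(t,f)=\frac1{\sqrt n}\sum_{i=1}^{\lfloor nt\rfloor}\bigl(f(X_{i,n})-E[f(X_{i,n})]\bigr).$$ Put $S_{n,i,j}(\varphi)=\sum_{k=i}^{j}\bigl(\varphi(X_{k,n})-E[\varphi(X_{k,n})]\bigr)$ for $1\le i\le j\le n$. For an arbitrary map $Y$ on $\Omega$, $E^*[Y]$ is the infimum of $E[U]$ over all measurable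 $U:\Omega\to[-\infty,\infty]$ with $U\ge Y$ for which $E[U]$ exists, and $P^*$ is the outer probability of $P$. Let $\rho$ be a semimetric on $\mathcal F$ (symmetric, zero on the diagonal, with the triangle inequality; distinct points may have distance $0$), let $\mathcal F_\delta=\{f-g: f,g\in\mathcal F,\ \rho(f,g)\le\delta\}$ for $\delta>0$, and let $\tau((s,f),(t,g))=|s-t|+\rho(f,g)$ on $[0,1]\times\mathcal F$. For $\alpha>1$ and $g:\{1,2,\dots\}\to\mathbb R$, the pair $(\alpha,g)$ fulfills condition (S) with index $Q\in[1,2^{(\alpha-1)/\alpha})$ if $g\ge0$, $g$ is nondecreasing, and $g(i)+g(j-i)\le Q\,g(j)$ for all $1\le i<j$. Weak convergence $\mathbb Z_n\Rightarrow\mathbb Z$ to a Borel measurable random element $\mathbb Z$ of $\ell^\infty([0,1]\times\mathcal F)$ (defined on some probability space) means $E^*[H(\mathbb Z_n)]\to E[H(\mathbb Z)]$ for all bounded continuous $H:\ell^\infty([0,1]\times\mathcal F)\to\mathbb R$; fidi-convergence means weak convergence of the laws of all vectors $(\mathbb Z_n(t_1,f_1),\dots,\mathbb Z_n(t_k,f_k))$.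 **Corollary.** Let $\nu>2$, $\kappa\in(0,\tfrac12-\tfrac1\nu)$, $C\ge0$, let $R,J:(0,\infty)\to[0,\infty)$ with $\lim_{\delta\downarrow0}R(\delta)=0$, and put $$\gamma(m,\delta)=C\,m\,\bigl(R(\delta)+J(\delta)m^{-\kappa}\bigr)^2,\qquad m\in\mathbb N,\ \delta>0.$$ Let $(\mathcal F,\rho)$ be totally bounded with $0\in\mathcal F$, and suppose that for all $\delta>0$, $n\in\mathbb N$ and $1\le i\le j\le n$ $$E^*\Bigl[\sup_{\varphi\in\mathcal F_\delta}|S_{n,i,j}(\varphi)|^\nu\Bigr]\le\gamma^{\nu/2}(j-i+1,\delta).$$ Then the following hold. (A) There are $g:\mathbb N\times(0,\infty)\to\mathbb R$ and $h:\mathbb N\to\mathbb R$ (with the convention $h(0)=0$) such that 1. $E^*[\sup_{\varphi\in\mathcal F_\delta}|S_{n,i,j}(\varphi)|^\nu]\le g^{\nu/2}(j-i+1,\delta)$ for all $n$, all $\delta>0$ and all $1\le i\le j\le n$, and there is one $Q_g\in[1,2^{1-2/\nu})$ such that $(\nu/2,g(\cdot,\delta))$ fulfills (S) with index $Q_g$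 for every $\delta>0$; 2. $E^*[\sup_{f\in\mathcal F}|S_{n,i,j}(f)|^\nu]\le h^{\nu/2}(j-i+1)$ for all $n$ and all $1\le i\le j\le n$, and $(\nu/2,h)$ fulfills (S) with some index $Q_h\in[1,2^{1-2/\nu})$; 3. $\lim_{\delta\downarrow0}\limsup_{n\to\infty}g(n,\delta)/n=0$; 4. there is $C'\ge0$ with $\limsup_{n\to\infty}h(\lfloor n\varepsilon\rfloor)/n\le C'\varepsilon$ for all $0<\varepsilon\le1$. (B) $\mathbb Z_n$ is asymptotically uniformly equicontinuous in probability with respect to $\tau$: for every $\varepsilon>0$, $$\lim_{\delta\downarrow0}\limsup_{n\to\infty}P^*\Bigl(\sup_{\tau((s,f),(t,g))\le\delta}|\mathbb Z_n(s,f)-\mathbb Z_n(t,g)|>\varepsilon\Bigr)=0.$$ (C) Fidi-convergence of $\mathbb Z_n$ implies weak convergence in $\ell^\infty([0,1]\times\mathcal F)$: if $\mathbb Z$ is a tight Borel measurable random element of $\ell^\infty([0,1]\times\mathcal F)$ and the finite-dimensional marginals of $\mathbb Z_n$ converge weakly to those of $\mathbb Z$, then $\mathbb Z_n\Rightarrow\mathbb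 Z$; and if each finite-dimensional marginal of $\mathbb Z_n$ merely converges weakly to some probability law, then $\mathbb Z_n$ converges weakly to some tight Borel probability law on $\ell^\infty([0,1]\times\mathcal F)$. -/

import Mathlib

open Filter Topology MeasureTheory
open scoped ENNReal BoundedContinuousFunction

noncomputable section

namespace SeqEmp

/-! ### Outer expectations -/

/-- The expectation of an extended-real map exists if its positive or its negative part has a
finite integral. -/
def ExpectationExists {Ω : Type*} [MeasurableSpace Ω] (P : Measure Ω) (U : Ω → EReal) : Prop :=
  ∫⁻ ω, (U ω).toENNReal ∂P ≠ ∞ ∨ ∫⁻ ω, (-U ω).toENNReal ∂P ≠ ∞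

/-- The expectation `E[U⁺] - E[U⁻]` of an extended-real map (used where it exists). -/
def extExpectation {Ω : Type*} [MeasurableSpace Ω] (P : Measure Ω) (U : Ω → EReal) : EReal :=
  ((∫⁻ ω, (U ω).toENNReal ∂P : ℝ≥0∞) : EReal) - ((∫⁻ ω, (-U ω).toENNReal ∂P : ℝ≥0∞) : EReal)

/-- The outer expectation `E*[Y]` of an arbitrary map: the infimum of `E[U]` over all measurable
extended-real `U ≥ Y` whose expectation exists. -/
def outerExpectation {Ω : Type*} [MeasurableSpace Ω] (P : Measure Ω) (Y : Ω → EReal) : EReal :=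
  sInf {e : EReal | ∃ U : Ω → EReal, Measurable U ∧ (∀ ω, Y ω ≤ U ω) ∧
    ExpectationExists P U ∧ e = extExpectation P U}

/-! ### The space of bounded functions, weak convergence and fidi-convergence -/

/-- The space `ℓ^∞(Ψ)` of bounded real functions on `Ψ` with the supremum norm. -/
abbrev Linf (Ψ : Type*) : Type _ := lp (fun _ : Ψ => ℝ) ∞

instance instMeasurableSpaceLinf (Ψ : Type*) : MeasurableSpace (Linf Ψ) := borel (Linf Ψ)

instance instBorelSpaceLinf (Ψ : Type*) : BorelSpace (Linf Ψ) := ⟨rfl⟩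

/-- `Zn ⇒ Z` in `ℓ^∞(Ψ)` in the sense of Hoffmann-Jørgensen, the `Zn` being arbitrary maps:
`E*[H(Zn)] → E[H(Z)]` for all bounded continuous `H : ℓ^∞(Ψ) → ℝ`. -/
def WeakConv {Ω Ω' Ψ : Type*} [MeasurableSpace Ω] [MeasurableSpace Ω'] (P : Measure Ω)
    (Zn : ℕ → Ω → Linf Ψ) (P' : Measure Ω') (Z : Ω' → Linf Ψ) : Prop :=
  ∀ H : Linf Ψ →ᵇ ℝ,
    Tendsto (fun n => outerExpectation P (fun ω => ((H (Zn n ω) : ℝ) : EReal))) atTop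
      (𝓝 ((∫ ω', H (Z ω') ∂P' : ℝ) : EReal))

/-- `Z` is a tight Borel measurable random element of `ℓ^∞(Ψ)`. -/
def IsTightRandomElement {Ω' Ψ : Type*} [MeasurableSpace Ω'] (P' : Measure Ω')
    (Z : Ω' → Linf Ψ) : Prop :=
  Measurable Z ∧ IsTightMeasureSet {P'.map Z}

/-- Weak convergence of the marginal of `Zn` at the points `ψ 0, …, ψ (k - 1)` to the law `μ`. -/
def MarginalConv {Ω Ψ : Type*} [MeasurableSpace Ω] (P : Measure Ω) (Zn : ℕ → Ω → Linf Ψ)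
    {k : ℕ} (ψ : Fin k → Ψ) (μ : Measure (Fin k → ℝ)) : Prop :=
  ∀ φ : (Fin k → ℝ) →ᵇ ℝ,
    Tendsto (fun n => ∫ ω, φ (fun l => Zn n ω (ψ l)) ∂P) atTop (𝓝 (∫ x, φ x ∂μ))

/-- Fidi-convergence of `Zn` to the random element `Z`. -/
def FidiConv {Ω Ω' Ψ : Type*} [MeasurableSpace Ω] [MeasurableSpace Ω'] (P : Measure Ω)
    (Zn : ℕ → Ω → Linf Ψ) (P' : Measure Ω') (Z : Ω' → Linf Ψ) : Prop :=
  ∀ (k : ℕ) (ψ : Fin k → Ψ), MarginalConv P Zn ψ (P'.map (fun ω' l => Z ω' (ψ l)))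

/-- Fidi-convergence of `Zn` without a prescribed limit: each finite-dimensional marginal converges
weakly to some probability law. -/
def FidiConvergent {Ω Ψ : Type*} [MeasurableSpace Ω] (P : Measure Ω)
    (Zn : ℕ → Ω → Linf Ψ) : Prop :=
  ∀ (k : ℕ) (ψ : Fin k → Ψ), ∃ μ : Measure (Fin k → ℝ),
    IsProbabilityMeasure μ ∧ MarginalConv P Zn ψ μ

/-! ### The sequential empirical process

A triangular array is a family `X n i`, of which only the entries with `1 ≤ i ≤ n` matter. -/

/-- The framework: the entries of the array are random variables, the functions in `𝓕` are
measurable, and there is a finite measurable envelope `F` with `E[F(X n i)] < ∞`. -/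
structure Framework {Ω 𝒳 : Type*} [MeasurableSpace Ω] [MeasurableSpace 𝒳] (P : Measure Ω)
    (X : ℕ → ℕ → Ω → 𝒳) (𝓕 : Set (𝒳 → ℝ)) : Prop where
  measurable_array : ∀ n i, 1 ≤ i → i ≤ n → Measurable (X n i)
  measurable_class : ∀ f ∈ 𝓕, Measurable f
  envelope : ∃ F : 𝒳 → ℝ, Measurable F ∧ (∀ f ∈ 𝓕, ∀ x, |f x| ≤ F x) ∧
    ∀ n i, 1 ≤ i → i ≤ n → Integrable (fun ω => F (X n i ω)) P

/-- The centered variables `Z°_{i,n}(φ) = φ(X_{i,n}) - E[φ(X_{i,n})]`. -/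
def centered {Ω 𝒳 : Type*} [MeasurableSpace Ω] (P : Measure Ω) (X : ℕ → ℕ → Ω → 𝒳)
    (n i : ℕ) (φ : 𝒳 → ℝ) (ω : Ω) : ℝ :=
  φ (X n i ω) - ∫ ω', φ (X n i ω') ∂P

/-- The partial sums `S_{n,i,j}(φ) = ∑_{k=i}^j Z°_{k,n}(φ)`. -/
def partialSum {Ω 𝒳 : Type*} [MeasurableSpace Ω] (P : Measure Ω) (X : ℕ → ℕ → Ω → 𝒳)
    (n i j : ℕ) (φ : 𝒳 → ℝ) (ω : Ω) : ℝ :=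
  ∑ k ∈ Finset.Icc i j, centered P X n k φ ω

/-- `Z_n(t,f) = n^{-1/2} ∑_{i=1}^{⌊nt⌋} (f(X_{i,n}) - E[f(X_{i,n})])`. -/
def seqEmp {Ω 𝒳 : Type*} [MeasurableSpace Ω] (P : Measure Ω) (X : ℕ → ℕ → Ω → 𝒳)
    (n : ℕ) (t : ℝ) (f : 𝒳 → ℝ) (ω : Ω) : ℝ :=
  1 / √(n : ℝ) * partialSum P X n 1 ⌊(n : ℝ) * t⌋₊ f ω

/-- The index set `[0,1] × 𝓕`. -/
abbrev Idx {𝒳 : Type*} (𝓕 : Set (𝒳 → ℝ)) : Type _ := Set.Icc (0 : ℝ) 1 × 𝓕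

theorem memlp_seqEmp {Ω 𝒳 : Type*} [MeasurableSpace Ω] [MeasurableSpace 𝒳] {P : Measure Ω}
    {X : ℕ → ℕ → Ω → 𝒳} {𝓕 : Set (𝒳 → ℝ)} (hF : Framework P X 𝓕) (n : ℕ) (ω : Ω) :
    Memℓp (fun p : Idx 𝓕 => seqEmp P X n p.1 p.2 ω) ∞ := by
  obtain ⟨F, -, hFb, hFi⟩ := hF.envelope
  apply memℓp_infty
  refine ⟨1 / √(n : ℝ) * ∑ k ∈ Finset.Icc 1 n, (F (X n k ω) + ∫ ω', F (X n k ω') ∂P), ?_⟩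
  rintro _ ⟨⟨t, f⟩, rfl⟩
  have hterm : ∀ k ∈ Finset.Icc 1 n,
      |centered P X n k f ω| ≤ F (X n k ω) + ∫ ω', F (X n k ω') ∂P := by
    intro k hk
    rw [Finset.mem_Icc] at hk
    refine (abs_sub _ _).trans (add_le_add (hFb _ f.2 _) ?_)
    rw [← Real.norm_eq_abs]
    exact norm_integral_le_of_norm_le (hFi n k hk.1 hk.2)
      (Eventually.of_forall fun ω' => hFb _ f.2 _)
  have hfl : ⌊(n : ℝ) * t⌋₊ ≤ n := by
    apply Nat.floor_le_of_le
    exact mul_le_of_le_one_right (Nat.cast_nonneg n) t.2.2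
  have hsub : Finset.Icc 1 ⌊(n : ℝ) * t⌋₊ ⊆ Finset.Icc 1 n := Finset.Icc_subset_Icc_right hfl
  change ‖seqEmp P X n t f ω‖ ≤ _
  rw [seqEmp, norm_mul, Real.norm_of_nonneg (by positivity : (0 : ℝ) ≤ 1 / √(n : ℝ)),
    Real.norm_eq_abs]
  refine mul_le_mul_of_nonneg_left ?_ (by positivity)
  refine (Finset.abs_sum_le_sum_abs _ _).trans ?_
  refine (Finset.sum_le_sum fun k hk => hterm k (hsub hk)).trans ?_
  exact Finset.sum_le_sum_of_subset_of_nonneg hsub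
    fun k hk _ => (abs_nonneg _).trans (hterm k hk)

/-- The sequential empirical process `Z_n` as a map `Ω → ℓ^∞([0,1] × 𝓕)`. -/
def seqEmpLinf {Ω 𝒳 : Type*} [MeasurableSpace Ω] [MeasurableSpace 𝒳] {P : Measure Ω}
    {X : ℕ → ℕ → Ω → 𝒳} {𝓕 : Set (𝒳 → ℝ)} (hF : Framework P X 𝓕) (n : ℕ) (ω : Ω) :
    Linf (Idx 𝓕) :=
  ⟨fun p : Idx 𝓕 => seqEmp P X n p.1 p.2 ω, memlp_seqEmp hF n ω⟩

/-! ### Asymptotic equicontinuity -/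

/-- `τ((s,f),(t,g)) = |s - t| + ρ(f,g)`. -/
def tau {𝒳 : Type*} {𝓕 : Set (𝒳 → ℝ)} (ρ : PseudoMetricSpace 𝓕) (p q : Idx 𝓕) : ℝ :=
  |(p.1 : ℝ) - (q.1 : ℝ)| + ρ.dist p.2 q.2

/-- Asymptotic uniform equicontinuity in probability of `Z_n` with respect to `τ`. The measure of a
possibly nonmeasurable set is, in Mathlib, its outer probability
`P*(B) = inf {P(A) | B ⊆ A, A measurable}`. -/
def AEC {Ω 𝒳 : Type*} [MeasurableSpace Ω] (P : Measure Ω) (X : ℕ → ℕ → Ω → 𝒳)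
    {𝓕 : Set (𝒳 → ℝ)} (τ : Idx 𝓕 → Idx 𝓕 → ℝ) : Prop :=
  ∀ ε : ℝ, 0 < ε →
    Tendsto (fun δ : ℝ => limsup (fun n : ℕ =>
        P {ω | (ε : EReal) < ⨆ (p : Idx 𝓕) (q : Idx 𝓕) (_ : τ p q ≤ δ),
          ((|seqEmp P X n p.1 p.2 ω - seqEmp P X n q.1 q.2 ω| : ℝ) : EReal)}) atTop)
      (𝓝[>] 0) (𝓝 0)

/-! ### The conditions of the uniform functional central limit theorem -/

/-- `𝓕_δ = {f - g | f, g ∈ 𝓕, ρ(f,g) ≤ δ}`. -/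
def diffClass {𝒳 : Type*} {𝓕 : Set (𝒳 → ℝ)} (ρ : PseudoMetricSpace 𝓕) (δ : ℝ) :
    Set (𝒳 → ℝ) :=
  {φ | ∃ f g : 𝓕, ρ.dist f g ≤ δ ∧ φ = (f : 𝒳 → ℝ) - (g : 𝒳 → ℝ)}

/-- `E*[sup_{φ ∈ 𝓖} |S_{n,i,j}(φ)|^ν]`. -/
def supMoment {Ω 𝒳 : Type*} [MeasurableSpace Ω] (P : Measure Ω) (X : ℕ → ℕ → Ω → 𝒳)
    (𝓖 : Set (𝒳 → ℝ)) (ν : ℝ) (n i j : ℕ) : EReal :=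
  outerExpectation P (fun ω => ⨆ φ ∈ 𝓖, ((|partialSum P X n i j φ ω| ^ ν : ℝ) : EReal))

/-- The pair `(α, g)` fulfills condition (S) with index `Q ∈ [1, 2^{(α-1)/α})`; here `g` is a
function on `{1, 2, …}`, so that its value at `0` is not restricted. -/
structure ConditionS (α : ℝ) (g : ℕ → ℝ) (Q : ℝ) : Prop where
  one_le_index : 1 ≤ Q
  index_lt : Q < 2 ^ ((α - 1) / α)
  nonneg : ∀ m, 1 ≤ m → 0 ≤ g m
  monotone : ∀ m m', 1 ≤ m → m ≤ m' → g m ≤ g m'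
  add_le : ∀ i j, 1 ≤ i → i < j → g i + g (j - i) ≤ Q * g j

/-- The conditions 1-4 of the uniform functional central limit theorem for the sequential
empirical process. -/
def UniformFCLTConditions {Ω 𝒳 : Type*} [MeasurableSpace Ω] (P : Measure Ω)
    (X : ℕ → ℕ → Ω → 𝒳) (𝓕 : Set (𝒳 → ℝ)) (ρ : PseudoMetricSpace 𝓕) (ν : ℝ) : Prop :=
  (∃ g : ℕ → ℝ → ℝ,
    (∀ (n : ℕ) (δ : ℝ) (i j : ℕ), 0 < δ → 1 ≤ i → i ≤ j → j ≤ n →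
      supMoment P X (diffClass ρ δ) ν n i j ≤ ((g (j - i + 1) δ ^ (ν / 2) : ℝ) : EReal)) ∧
    (∃ Qg : ℝ, ∀ δ : ℝ, 0 < δ → ConditionS (ν / 2) (fun m => g m δ) Qg) ∧
    Tendsto (fun δ : ℝ => limsup (fun n : ℕ => ((g n δ / (n : ℝ) : ℝ) : EReal)) atTop)
      (𝓝[>] 0) (𝓝 0)) ∧
  (∃ h : ℕ → ℝ, h 0 = 0 ∧
    (∀ n i j : ℕ, 1 ≤ i → i ≤ j → j ≤ n →
      supMoment P X 𝓕 ν n i j ≤ ((h (j - i + 1) ^ (ν / 2) : ℝ) : EReal)) ∧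
    (∃ Qh : ℝ, ConditionS (ν / 2) h Qh) ∧
    (∃ C : ℝ, 0 ≤ C ∧ ∀ ε : ℝ, 0 < ε → ε ≤ 1 →
      limsup (fun n : ℕ => ((h ⌊(n : ℝ) * ε⌋₊ / (n : ℝ) : ℝ) : EReal)) atTop
        ≤ ((C * ε : ℝ) : EReal)))

/-- `γ(m,δ) = C m (R(δ) + J(δ) m^{-κ})²`. -/
def gammaBound (C κ : ℝ) (R J : ℝ → ℝ) (m : ℕ) (δ : ℝ) : ℝ :=
  C * (m : ℝ) * (R δ + J δ * (m : ℝ) ^ (-κ)) ^ 2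

end SeqEmp

end

/-! Everything rests on how fast `γ` grows. Passing from length `j` to `i ≤ j` increases `m ^ (-κ)`
by the factor `(i/j) ^ (-κ)`, hence `γ(i,δ) ≤ (i/j) ^ (1 - 2κ) * γ(j,δ)` (`gammaBound_le_rpow_mul`).
With concavity of `x ↦ x ^ (1 - 2κ)` this gives condition (S) with index `2 ^ (2κ)`, which is
admissible exactly because `κ < 1/2 - 1/ν`. So `g = γ` works, and `h = γ(·,D)` works once `D` bounds
the diameter of `𝓕`, since `0 ∈ 𝓕` puts `𝓕` inside the difference class at `D`.

The same growth rate drives a maximal inequality by dyadic bisection. The maximal increment over a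
block of length `2m` is at most one increment of length `m` plus the larger of two maximal
increments of length `m`. In `L^ν` the maximum of two costs a factor `2 ^ (1/ν)`, while doubling the
length gains at least `2 ^ (1/2 - κ)` in `√γ`; the gain wins, so the constants stay bounded.
Nonmeasurable suprema are handled by carrying measurable majorants through the recursion.

For equicontinuity, an increment of `Z_n` splits into a change of function at a fixed time and a
change of time for a fixed function. The first has probability of order `(R(δ) + J(δ) n ^ (-κ)) ^
ν`. The second is covered by about `1/δ` blocks of length about `nδ`, each of probability of order
`δ ^ (ν/2)`, and `δ ^ (ν/2 - 1)` vanishes because `ν > 2`.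

Total boundedness then makes `Z_n` uniformly close, up to small outer probability, to functions of
finitely many coordinates (`FinitelyApproximable`). For bounded Lipschitz test functions this
replacement is harmless (`outerExpectation_approx`), and these suffice. Given a tight limit, the
approximation passes to it and fidi-convergence concludes. Without one, the finite-rank
approximations along a fast subsequence are tight, and a limit of their laws along an ultrafilter is
the weak limit of the whole sequence. -/

noncomputable section

namespace SeqEmp

/-! ### Outer expectations: comparison with integrals, measurable majorants, stability. -/

section OuterExpectation

variable {Ω : Type*} [MeasurableSpace Ω] {P : Measure Ω}

theorem outerExpectation_mono {Y Y' : Ω → EReal} (h : ∀ ω, Y ω ≤ Y' ω) :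
    outerExpectation P Y ≤ outerExpectation P Y' :=
  sInf_le_sInf fun _ ⟨U, hU, hle, hex, he⟩ => ⟨U, hU, fun ω => (h ω).trans (hle ω), hex, he⟩

theorem lintegral_toENNReal_coe_ne_top {V : Ω → ℝ} (hV : Integrable V P) :
    ∫⁻ ω, ((V ω : ℝ) : EReal).toENNReal ∂P ≠ ∞ := by
  simp only [EReal.real_coe_toENNReal]
  exact hV.lintegral_lt_top.ne

theorem lintegral_toENNReal_neg_coe_ne_top {V : Ω → ℝ} (hV : Integrable V P) :
    ∫⁻ ω, (-((V ω : ℝ) : EReal)).toENNReal ∂P ≠ ∞ := by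
  simp only [← EReal.coe_neg, EReal.real_coe_toENNReal]
  exact hV.neg.lintegral_lt_top.ne

theorem extExpectation_coe {V : Ω → ℝ} (hV : Integrable V P) :
    extExpectation P (fun ω => (V ω : EReal)) = ((∫ ω, V ω ∂P : ℝ) : EReal) := by
  have h1 := lintegral_toENNReal_coe_ne_top hV
  have h2 := lintegral_toENNReal_neg_coe_ne_top hV
  rw [integral_eq_lintegral_pos_part_sub_lintegral_neg_part hV, extExpectation]
  simp only [← EReal.coe_neg, EReal.real_coe_toENNReal] at h1 h2 ⊢
  rw [EReal.coe_sub, EReal.coe_ennreal_toReal h1, EReal.coe_ennreal_toReal h2]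

theorem outerExpectation_le_integral {Y : Ω → EReal} {V : Ω → ℝ} (hm : Measurable V)
    (hV : Integrable V P) (h : ∀ ω, Y ω ≤ (V ω : EReal)) :
    outerExpectation P Y ≤ ((∫ ω, V ω ∂P : ℝ) : EReal) :=
  sInf_le ⟨fun ω => (V ω : EReal), hm.coe_real_ereal, h,
    Or.inl (lintegral_toENNReal_coe_ne_top hV), (extExpectation_coe hV).symm⟩

theorem integral_le_outerExpectation {Y : Ω → EReal} {V : Ω → ℝ}
    (hV : Integrable V P) (h : ∀ ω, (V ω : EReal) ≤ Y ω) :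
    ((∫ ω, V ω ∂P : ℝ) : EReal) ≤ outerExpectation P Y := by
  refine le_sInf ?_
  rintro _ ⟨U, -, hle, -, rfl⟩
  rw [← extExpectation_coe hV]
  refine EReal.sub_le_sub ?_ ?_
  · exact EReal.coe_ennreal_le_coe_ennreal_iff.2
      (lintegral_mono fun ω => EReal.toENNReal_le_toENNReal ((h ω).trans (hle ω)))
  · exact EReal.coe_ennreal_le_coe_ennreal_iff.2 (lintegral_mono fun ω =>
      EReal.toENNReal_le_toENNReal (EReal.neg_le_neg_iff.2 ((h ω).trans (hle ω))))

/-- The infimum in the outer expectation of a nonnegative map is attained. -/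
theorem exists_measurable_majorant {Y : Ω → EReal} (h0 : ∀ ω, 0 ≤ Y ω) {c : ℝ}
    (hc : outerExpectation P Y ≤ (c : EReal)) :
    ∃ W : Ω → ℝ≥0∞, Measurable W ∧ (∀ ω, (Y ω).toENNReal ≤ W ω) ∧
      ∫⁻ ω, W ω ∂P ≤ ENNReal.ofReal c := by
  have key : ∀ k : ℕ, ∃ W : Ω → ℝ≥0∞, Measurable W ∧ (∀ ω, (Y ω).toENNReal ≤ W ω) ∧
      ∫⁻ ω, W ω ∂P ≤ ENNReal.ofReal (c + 1 / ((k : ℝ) + 1)) := by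
    intro k
    have hk : (0 : ℝ) < 1 / ((k : ℝ) + 1) := by positivity
    have hlt : outerExpectation P Y < ((c + 1 / ((k : ℝ) + 1) : ℝ) : EReal) :=
      hc.trans_lt (by exact_mod_cast lt_add_of_pos_right c hk)
    obtain ⟨_, ⟨U, hU, hle, -, rfl⟩, hlt⟩ := sInf_lt_iff.1 hlt
    refine ⟨fun ω => (U ω).toENNReal, hU.ereal_toENNReal,
      fun ω => EReal.toENNReal_le_toENNReal (hle ω), ?_⟩
    -- Since `U ≥ Y ≥ 0`, only the positive part contributes to `extExpectation`.
    have hneg : ∀ ω, (-U ω).toENNReal = 0 := fun ω =>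
      EReal.toENNReal_of_nonpos (by simpa using (h0 ω).trans (hle ω))
    simp only [extExpectation, hneg, lintegral_zero, EReal.coe_ennreal_zero, sub_zero] at hlt
    rw [← EReal.coe_ennreal_le_coe_ennreal_iff]
    refine hlt.le.trans ?_
    rw [EReal.coe_ennreal_ofReal]
    exact_mod_cast le_max_left _ _
  choose W hW hle hint using key
  refine ⟨fun ω => ⨅ k, W k ω, Measurable.iInf hW, fun ω => le_iInf fun k => hle k ω, ?_⟩
  have hlim : Tendsto (fun k : ℕ => ENNReal.ofReal (c + 1 / ((k : ℝ) + 1))) atTop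
      (𝓝 (ENNReal.ofReal c)) := by
    refine ENNReal.tendsto_ofReal ?_
    simpa using tendsto_const_nhds.add (tendsto_one_div_add_atTop_nhds_zero_nat (𝕜 := ℝ))
  exact ge_of_tendsto' hlim fun k => (lintegral_mono fun ω => iInf_le _ k).trans (hint k)

/-- Replacing `Z` by a map `Y` that is close to it in outer probability hardly changes the outer
expectation of a bounded Lipschitz function. -/
theorem outerExpectation_approx [IsProbabilityMeasure P] {E : Type*} [PseudoMetricSpace E]
    {H : E → ℝ} {K : NNReal} (hL : LipschitzWith K H) {B : ℝ} (hB : ∀ x, |H x| ≤ B)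
    {Z Y : Ω → E} (hY : Measurable fun ω => H (Y ω)) {η : ℝ} (hη : 0 ≤ η)
    (hP : P {ω | η < dist (Z ω) (Y ω)} ≤ ENNReal.ofReal η) :
    ((∫ ω, H (Y ω) ∂P - (K + 2 * B) * η : ℝ) : EReal)
        ≤ outerExpectation P (fun ω => (H (Z ω) : EReal)) ∧
      outerExpectation P (fun ω => (H (Z ω) : EReal))
        ≤ ((∫ ω, H (Y ω) ∂P + (K + 2 * B) * η : ℝ) : EReal) := by
  classical
  -- The exceptional set need not be measurable; its measurable hull has the same outer probability.
  -- On it the crude bound `2 * B` is used, off it the Lipschitz bound.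
  set D := toMeasurable P {ω | η < dist (Z ω) (Y ω)} with hD
  have hDm : MeasurableSet D := measurableSet_toMeasurable _ _
  have hPD : P.real D ≤ η := by
    rw [Measure.real, hD, measure_toMeasurable]
    exact ENNReal.toReal_le_of_le_ofReal hη hP
  have hBnn : 0 ≤ B := by
    obtain ⟨ω⟩ := P.nonempty_of_neZero
    exact (abs_nonneg _).trans (hB (Y ω))
  have hbd : ∀ ω, |H (Z ω) - H (Y ω)| ≤ K * η + D.indicator (fun _ => 2 * B) ω := by
    intro ω
    by_cases hω : ω ∈ D
    · rw [Set.indicator_of_mem hω]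
      have := abs_sub (H (Z ω)) (H (Y ω))
      have h1 := hB (Z ω)
      have h2 := hB (Y ω)
      have : 0 ≤ K * η := by positivity
      linarith
    · rw [Set.indicator_of_notMem hω, add_zero]
      have h1 : ¬ η < dist (Z ω) (Y ω) := fun h => hω (subset_toMeasurable _ _ h)
      rw [← Real.dist_eq]
      exact (hL.dist_le_mul _ _).trans (by gcongr; exact not_lt.1 h1)
  have hHY : Integrable (fun ω => H (Y ω)) P :=
    Integrable.of_bound hY.aestronglyMeasurable B (Eventually.of_forall fun ω => hB _)
  have hind : Integrable (fun ω => K * η + D.indicator (fun _ => 2 * B) ω) P :=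
    (integrable_const _).add ((integrable_const _).indicator hDm)
  have hindm : Measurable (fun ω => K * η + D.indicator (fun _ => 2 * B) ω) :=
    measurable_const.add (measurable_const.indicator hDm)
  have hval : ∫ ω, (K * η + D.indicator (fun _ => 2 * B) ω) ∂P ≤ (K + 2 * B) * η := by
    rw [integral_add (integrable_const _) ((integrable_const _).indicator hDm),
      integral_indicator_const _ hDm]
    simp only [integral_const, probReal_univ, smul_eq_mul, one_mul]
    nlinarith
  constructor
  · have := integral_le_outerExpectation (P := P) (Y := fun ω => (H (Z ω) : EReal))
      (hHY.sub hind) (fun ω => by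
        have := abs_le.1 (hbd ω)
        simp only [Pi.sub_apply]
        exact_mod_cast (by linarith))
    refine le_trans ?_ this
    simp only [Pi.sub_apply]
    rw [integral_sub hHY hind]
    exact_mod_cast (by linarith)
  · have := outerExpectation_le_integral (P := P) (Y := fun ω => (H (Z ω) : EReal))
      (hY.add hindm) (hHY.add hind) (fun ω => by
        have := abs_le.1 (hbd ω)
        simp only [Pi.add_apply]
        exact_mod_cast (by linarith))
    refine this.trans ?_
    simp only [Pi.add_apply]
    rw [integral_add hHY hind]
    exact_mod_cast (by linarith)

end OuterExpectation

/-- A sequence in `EReal` that is squeezed around a real number converges to it. -/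
theorem tendsto_coe_of_forall_eventually {ι : Type*} {l : Filter ι} {a : ι → EReal} {c : ℝ}
    (h : ∀ ε : ℝ, 0 < ε → ∀ᶠ n in l, ((c - ε : ℝ) : EReal) ≤ a n ∧ a n ≤ ((c + ε : ℝ) : EReal)) :
    Tendsto a l (𝓝 (c : EReal)) := by
  refine tendsto_order.2 ⟨fun b hb => ?_, fun b hb => ?_⟩
  · obtain ⟨x, hbx, hxc⟩ := EReal.lt_iff_exists_real_btwn.1 hb
    have hxc' : x < c := by exact_mod_cast hxc
    filter_upwards [h (c - x) (by linarith)] with n hn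
    refine hbx.trans_le ?_
    simpa using hn.1
  · obtain ⟨x, hcx, hxb⟩ := EReal.lt_iff_exists_real_btwn.1 hb
    have hxc' : c < x := by exact_mod_cast hcx
    filter_upwards [h (x - c) (by linarith)] with n hn
    refine lt_of_le_of_lt ?_ hxb
    simpa using hn.2

/-! ### Lipschitz approximation -/

section Lipschitz

variable {E : Type*} [PseudoMetricSpace E]

/-- The sup-convolution `x ↦ sup_y (H y - k d(x,y))`. -/
def supConv (H : E →ᵇ ℝ) (k : ℕ) (x : E) : ℝ := ⨆ y, (H y - k * dist x y)

theorem bddAbove_supConv (H : E →ᵇ ℝ) (k : ℕ) (x : E) :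
    BddAbove (Set.range fun y => H y - k * dist x y) := by
  refine ⟨‖H‖, ?_⟩
  rintro _ ⟨y, rfl⟩
  have := (abs_le.1 (H.norm_coe_le_norm y)).2
  have : 0 ≤ (k : ℝ) * dist x y := by positivity
  simp only
  linarith

theorem le_supConv (H : E →ᵇ ℝ) (k : ℕ) (x : E) : H x ≤ supConv H k x := by
  have := le_ciSup (bddAbove_supConv H k x) x
  simpa [supConv] using this

theorem abs_supConv_le (H : E →ᵇ ℝ) (k : ℕ) (x : E) : |supConv H k x| ≤ ‖H‖ := by
  have : Nonempty E := ⟨x⟩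
  refine abs_le.2 ⟨(abs_le.1 (H.norm_coe_le_norm x)).1.trans (le_supConv H k x), ?_⟩
  refine ciSup_le fun y => ?_
  have := (abs_le.1 (H.norm_coe_le_norm y)).2
  have : 0 ≤ (k : ℝ) * dist x y := by positivity
  linarith

theorem lipschitzWith_supConv (H : E →ᵇ ℝ) (k : ℕ) : LipschitzWith k (supConv H k) := by
  refine LipschitzWith.of_le_add_mul _ fun x y => ?_
  have : Nonempty E := ⟨x⟩
  refine ciSup_le fun z => ?_
  have h1 := le_ciSup (bddAbove_supConv H k y) z
  have h2 : (k : ℝ) * dist y z ≤ k * dist x y + k * dist x z := by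
    rw [← mul_add]
    exact mul_le_mul_of_nonneg_left (dist_triangle_left y z x) k.cast_nonneg
  simp only [supConv, NNReal.coe_natCast] at h1 ⊢
  linarith

/-- Near `x` continuity controls `H y`; at distance at least `δ` the penalty exceeds the oscillation
`2 * ‖H‖` as soon as `k ≥ 2 * ‖H‖ / δ`. -/
theorem tendsto_supConv (H : E →ᵇ ℝ) (x : E) :
    Tendsto (fun k => supConv H k x) atTop (𝓝 (H x)) := by
  have : Nonempty E := ⟨x⟩
  rw [Metric.tendsto_nhds]
  intro ε hε
  obtain ⟨δ, hδ, hH⟩ := Metric.continuous_iff.1 H.continuous x (ε / 2) (half_pos hε)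
  have hev : ∀ᶠ k : ℕ in atTop, 2 * ‖H‖ / δ ≤ k :=
    tendsto_natCast_atTop_atTop.eventually_ge_atTop _
  filter_upwards [hev] with k hk
  rw [Real.dist_eq, abs_lt]
  refine ⟨by linarith [le_supConv H k x], ?_⟩
  have : supConv H k x ≤ H x + ε / 2 := by
    refine ciSup_le fun y => ?_
    have hnn : 0 ≤ (k : ℝ) * dist x y := by positivity
    by_cases hy : dist y x < δ
    · have := (abs_lt.1 (Real.dist_eq _ _ ▸ hH y hy)).2
      linarith
    · have h1 := (abs_le.1 (H.norm_coe_le_norm y)).2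
      have h2 := (abs_le.1 (H.norm_coe_le_norm x)).1
      rw [dist_comm, not_lt] at hy
      have h3 : 2 * ‖H‖ ≤ k * dist x y :=
        ((div_le_iff₀ hδ).1 hk).trans (mul_le_mul_of_nonneg_left hy k.cast_nonneg)
      linarith
  linarith

end Lipschitz

/-- Convergence of the outer expectations of bounded Lipschitz functions implies that of the outer
expectations of bounded continuous functions. -/
theorem tendsto_outerExpectation_of_lipschitz {Ω E : Type*} [MeasurableSpace Ω] {P : Measure Ω}
    [PseudoMetricSpace E] [MeasurableSpace E] [BorelSpace E] (Zn : ℕ → Ω → E)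
    (μ : Measure E) [IsProbabilityMeasure μ]
    (h : ∀ (H : E → ℝ) (K : NNReal) (B : ℝ), LipschitzWith K H → (∀ x, |H x| ≤ B) →
      Tendsto (fun n => outerExpectation P (fun ω => (H (Zn n ω) : EReal))) atTop
        (𝓝 ((∫ x, H x ∂μ : ℝ) : EReal))) (H : E →ᵇ ℝ) :
    Tendsto (fun n => outerExpectation P (fun ω => (H (Zn n ω) : EReal))) atTop
      (𝓝 ((∫ x, H x ∂μ : ℝ) : EReal)) := by
  have hlim : ∀ H : E →ᵇ ℝ,
      Tendsto (fun k => ∫ x, supConv H k x ∂μ) atTop (𝓝 (∫ x, H x ∂μ)) := fun H =>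
    tendsto_integral_of_dominated_convergence (fun _ => ‖H‖)
      (fun k => (lipschitzWith_supConv H k).continuous.measurable.aestronglyMeasurable)
      (integrable_const _) (fun k => Eventually.of_forall fun x => abs_supConv_le H k x)
      (Eventually.of_forall fun x => tendsto_supConv H x)
  refine tendsto_coe_of_forall_eventually fun ε hε => ?_
  -- `H` is sandwiched between the Lipschitz functions `-supConv (-H) j` and `supConv H k`, whose
  -- integrals are within `ε` of that of `H`.
  obtain ⟨k, hk⟩ := ((hlim H).eventually_lt_const
    (lt_add_of_pos_right (∫ x, H x ∂μ) hε)).exists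
  have hneg : ∫ x, (-H) x ∂μ = -∫ x, H x ∂μ := by
    simp [integral_neg]
  obtain ⟨j, hj⟩ := ((hlim (-H)).eventually_lt_const
    (lt_add_of_pos_right (∫ x, (-H) x ∂μ) hε)).exists
  have hup := h (supConv H k) k ‖H‖ (lipschitzWith_supConv H k) (abs_supConv_le H k)
  have hlow := h (fun x => -supConv (-H) j x) j ‖-H‖ (lipschitzWith_supConv (-H) j).neg
    (fun x => by rw [abs_neg]; exact abs_supConv_le (-H) j x)
  have h1 : ((∫ x, H x ∂μ - ε : ℝ) : EReal) < ((∫ x, -supConv (-H) j x ∂μ : ℝ) : EReal) := by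
    rw [integral_neg]
    exact_mod_cast (by linarith)
  have h2 : ((∫ x, supConv H k x ∂μ : ℝ) : EReal) < ((∫ x, H x ∂μ + ε : ℝ) : EReal) := by
    exact_mod_cast hk
  filter_upwards [hup.eventually_lt_const h2, hlow.eventually_const_lt h1] with n hn1 hn2
  refine ⟨hn2.le.trans (outerExpectation_mono fun ω => ?_),
    (outerExpectation_mono fun ω => ?_).trans hn1.le⟩
  · have := le_supConv (-H) j (Zn n ω)
    simp only [BoundedContinuousFunction.coe_neg, Pi.neg_apply] at this
    exact_mod_cast (by linarith)
  · exact_mod_cast le_supConv H k (Zn n ω)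

/-! ### Tightness -/

/-- The index set may be uncountable, so continuity from below is unavailable. Tightness replaces
it: up to `η` the union is exhausted by a compact set, which a single member of the directed family
already covers. -/
theorem measure_iUnion_le_of_directed_open {E ι : Type*} [MetricSpace E] [MeasurableSpace E]
    [BorelSpace E] [Nonempty ι] {μ : Measure E} [IsFiniteMeasure μ] (hμ : IsTightMeasureSet {μ})
    {U : ι → Set E} (hU : ∀ i, IsOpen (U i)) (hd : Directed (· ⊆ ·) U) {c : ℝ≥0∞}
    (hc : ∀ i, μ (U i) ≤ c) : μ (⋃ i, U i) ≤ c := by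
  refine ENNReal.le_of_forall_pos_le_add fun η hη _ => ?_
  have hη2 : (0 : ℝ≥0∞) < (η : ℝ≥0∞) / 2 := ENNReal.half_pos (by exact_mod_cast hη.ne')
  obtain ⟨K, hK, hKμ⟩ := isTightMeasureSet_iff_exists_isCompact_measure_compl_le.1 hμ _ hη2
  have hO : IsOpen (⋃ i, U i) := isOpen_iUnion hU
  obtain ⟨F, hFO, hF, hFμ⟩ := hO.measurableSet.exists_isClosed_lt_add (μ := μ)
    (measure_ne_top _ _) hη2.ne'
  obtain ⟨i, hi⟩ := (hK.inter_left hF).elim_directed_cover U hU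
    (Set.inter_subset_left.trans hFO) hd
  calc μ (⋃ i, U i) ≤ μ F + η / 2 := hFμ.le
    _ ≤ (μ (F ∩ K) + μ Kᶜ) + η / 2 := by
        gcongr
        refine (measure_mono ?_).trans (measure_union_le _ _)
        intro x hx
        by_cases hxK : x ∈ K
        · exact Or.inl ⟨hx, hxK⟩
        · exact Or.inr hxK
    _ ≤ (c + η / 2) + η / 2 := by
        gcongr
        · exact (measure_mono hi).trans (hc i)
        · exact hKμ μ rfl
    _ = c + η := by rw [add_assoc, ENNReal.add_halves]

/-- In a complete space, a set of measures that almost live on arbitrarily small neighbourhoods of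
compact sets is tight. -/
theorem isTightMeasureSet_of_cthickening {E : Type*} [MetricSpace E] [CompleteSpace E]
    [MeasurableSpace E] {S : Set (Measure E)}
    (h : ∀ ε : ℝ, 0 < ε → ∃ C : Set E, IsCompact C ∧
      ∀ μ ∈ S, μ (Metric.cthickening ε C)ᶜ ≤ ENNReal.ofReal ε) : IsTightMeasureSet S := by
  rw [isTightMeasureSet_iff_exists_isCompact_measure_compl_le]
  intro ε hε
  obtain ⟨u, hu, hsum⟩ := ENNReal.exists_pos_sum_of_countable hε.ne' ℕ
  -- The bound by `u i` makes the exceptional measures sum to at most `ε`; the bound by `1 / (i +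
  -- 1)` makes the intersection of the thickenings totally bounded.
  set r : ℕ → ℝ := fun i => min (u i : ℝ) (1 / ((i : ℝ) + 1)) with hr
  have hrpos : ∀ i, 0 < r i := fun i => lt_min (by exact_mod_cast hu i) (by positivity)
  choose C hC hCμ using fun i => h (r i) (hrpos i)
  refine ⟨⋂ i, Metric.cthickening (r i) (C i), ?_, fun μ hμ => ?_⟩
  · refine isCompact_iff_totallyBounded_isComplete.2
      ⟨?_, (isClosed_iInter fun i => Metric.isClosed_cthickening).isComplete⟩
    refine Metric.totallyBounded_iff.2 fun e he => ?_
    obtain ⟨i, hi⟩ := exists_nat_one_div_lt (half_pos he)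
    have hri : r i < e / 2 := (min_le_right _ _).trans_lt hi
    obtain ⟨t, ht, htC⟩ := Metric.totallyBounded_iff.1 (hC i).totallyBounded (e / 2) (half_pos he)
    refine ⟨t, ht, fun x hx => ?_⟩
    have hx' := Metric.cthickening_subset_thickening' (half_pos he) hri (C i) (Set.mem_iInter.1 hx i)
    obtain ⟨z, hz, hxz⟩ := Metric.mem_thickening_iff.1 hx'
    obtain ⟨y, hy, hzy⟩ := Set.mem_iUnion₂.1 (htC hz)
    refine Set.mem_iUnion₂.2 ⟨y, hy, ?_⟩
    rw [Metric.mem_ball] at hzy ⊢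
    linarith [dist_triangle x z y]
  · rw [Set.compl_iInter]
    refine (measure_iUnion_le _).trans (le_trans (ENNReal.tsum_le_tsum fun i => ?_) hsum.le)
    refine (hCμ i μ hμ).trans ?_
    rw [← ENNReal.ofReal_coe_nnreal]
    exact ENNReal.ofReal_le_ofReal (min_le_left _ _)

/-! ### Approximation by finitely many coordinates -/

section FiniteRank

variable {T : Type*}

theorem dist_le_of_forall {x y : Linf T} {ε : ℝ} (hε : 0 ≤ ε) (h : ∀ t, |x t - y t| ≤ ε) :
    dist x y ≤ ε := by
  rw [dist_eq_norm]
  exact lp.norm_le_of_forall_le hε h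

theorem abs_apply_sub_le_dist (x y : Linf T) (t : T) : |x t - y t| ≤ dist x y := by
  rw [dist_eq_norm]
  exact lp.norm_apply_le_norm ENNReal.top_ne_zero (x - y) t

theorem continuous_apply_linf (t : T) : Continuous fun x : Linf T => x t := by
  refine LipschitzWith.continuous (K := 1) (LipschitzWith.of_dist_le_mul fun x y => ?_)
  rw [NNReal.coe_one, one_mul, Real.dist_eq]
  exact abs_apply_sub_le_dist x y t

theorem memlp_comp_fin {k : ℕ} (π : T → Fin k) (x : Fin k → ℝ) :
    Memℓp (fun t => x (π t)) ∞ := by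
  refine memℓp_infty ⟨‖x‖, ?_⟩
  rintro _ ⟨t, rfl⟩
  exact norm_le_pi_norm x _

/-- The bounded function `t ↦ x (π t)` taking finitely many values. -/
def finiteRank {k : ℕ} (π : T → Fin k) (x : Fin k → ℝ) : Linf T :=
  ⟨fun t => x (π t), memlp_comp_fin π x⟩

theorem continuous_finiteRank {k : ℕ} (π : T → Fin k) : Continuous (finiteRank π) := by
  refine LipschitzWith.continuous (K := 1) (LipschitzWith.of_dist_le_mul fun x y => ?_)
  rw [NNReal.coe_one, one_mul]
  exact dist_le_of_forall dist_nonneg fun t => by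
    rw [← Real.dist_eq]
    exact dist_le_pi_dist x y (π t)

/-- Up to a small outer probability, the maps `Zn` are eventually uniformly close to maps that
depend on finitely many coordinates only. -/
def FinitelyApproximable {Ω : Type*} [MeasurableSpace Ω] (P : Measure Ω) (Zn : ℕ → Ω → Linf T) :
    Prop :=
  ∀ ε : ℝ, 0 < ε → ∃ (k : ℕ) (ψ : Fin k → T) (π : T → Fin k), ∀ᶠ n in atTop,
    P {ω | ∃ t, ε < |Zn n ω t - Zn n ω (ψ (π t))|} ≤ ENNReal.ofReal ε

variable {Ω : Type*} [MeasurableSpace Ω] {P : Measure Ω}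

theorem measure_lt_dist_finiteRank_le {k : ℕ} {ψ : Fin k → T} {π : T → Fin k} {Z : Ω → Linf T}
    {ε : ℝ} (hε : 0 ≤ ε) {c : ℝ≥0∞} (h : P {ω | ∃ t, ε < |Z ω t - Z ω (ψ (π t))|} ≤ c) :
    P {ω | ε < dist (Z ω) (finiteRank π fun l => Z ω (ψ l))} ≤ c := by
  refine (measure_mono fun ω hω => ?_).trans h
  by_contra hcon
  simp only [Set.mem_ofPred_eq, not_exists, not_lt] at hcon hω
  exact absurd (dist_le_of_forall hε hcon) (not_le.2 hω)

/-- Nonemptiness supplies the arbitrary value of `idx` off `S`. -/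
theorem exists_fin_enumeration (S : Finset T) (hS : S.Nonempty) :
    ∃ (k : ℕ) (ψ : Fin k → T) (idx : T → Fin k), ∀ t ∈ S, ψ (idx t) = t := by
  have : NeZero S.card := ⟨hS.card_pos.ne'⟩
  refine ⟨S.card, fun l => (S.equivFin.symm l : T),
    Function.invFun fun l => (S.equivFin.symm l : T), fun t ht => ?_⟩
  exact Function.invFun_eq (f := fun l => (S.equivFin.symm l : T))
    ⟨S.equivFin ⟨t, ht⟩, by simp⟩

theorem MarginalConv.tendsto_integral_finiteRank {Zn : ℕ → Ω → Linf T} {k : ℕ} {ψ : Fin k → T} {π : T → Fin k}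
    {μ : Measure (Fin k → ℝ)} (h : MarginalConv P Zn ψ μ) {H : Linf T → ℝ} (hH : Continuous H)
    {B : ℝ} (hB : ∀ x, |H x| ≤ B) :
    Tendsto (fun n => ∫ ω, H (finiteRank π fun l => Zn n ω (ψ l)) ∂P) atTop
      (𝓝 (∫ x, H (finiteRank π x) ∂μ)) :=
  h (BoundedContinuousFunction.ofNormedAddCommGroup (fun x => H (finiteRank π x))
    (hH.comp (continuous_finiteRank π)) B fun _ => hB _)

variable [IsProbabilityMeasure P] {Zn : ℕ → Ω → Linf T}

theorem measurable_marginal {Z : Ω → Linf T} (hZ : ∀ t, Measurable fun ω => Z ω t) {k : ℕ}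
    (ψ : Fin k → T) : Measurable (fun ω l => Z ω (ψ l) : Ω → Fin k → ℝ) :=
  measurable_pi_lambda _ fun l => hZ (ψ l)

/-- The law of a finite-dimensional marginal. -/
def marginalLaw (P : Measure Ω) [IsProbabilityMeasure P] {Z : Ω → Linf T}
    (hZ : ∀ t, Measurable fun ω => Z ω t) {k : ℕ} (ψ : Fin k → T) :
    ProbabilityMeasure (Fin k → ℝ) :=
  ⟨P.map (fun ω l => Z ω (ψ l) : Ω → Fin k → ℝ),
    Measure.isProbabilityMeasure_map (measurable_marginal hZ ψ).aemeasurable⟩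

theorem MarginalConv.tendsto_marginalLaw (hZ : ∀ n t, Measurable fun ω => Zn n ω t)
    {k : ℕ} {ψ : Fin k → T} {μ : ProbabilityMeasure (Fin k → ℝ)}
    (h : MarginalConv P Zn ψ μ) :
    Tendsto (fun n => marginalLaw P (hZ n) ψ) atTop (𝓝 μ) := by
  rw [ProbabilityMeasure.tendsto_iff_forall_integral_tendsto]
  intro φ
  refine (h φ).congr fun n => ?_
  exact (integral_map (measurable_marginal (hZ n) ψ).aemeasurable
    φ.continuous.measurable.aestronglyMeasurable).symm

/-- The approximation by finitely many coordinates is inherited by a tight fidi-limit. -/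
theorem measure_exists_lt_le_of_fidiConv (hZ : ∀ n t, Measurable fun ω => Zn n ω t)
    {Ω' : Type*} [MeasurableSpace Ω'] {P' : Measure Ω'} [IsProbabilityMeasure P']
    {Z : Ω' → Linf T} (hZt : IsTightRandomElement P' Z) (hfidi : FidiConv P Zn P' Z)
    {k : ℕ} {ψ : Fin k → T} {π : T → Fin k} {ε : ℝ} {c : ℝ≥0∞}
    (h : ∀ᶠ n in atTop, P {ω | ∃ t, ε < |Zn n ω t - Zn n ω (ψ (π t))|} ≤ c) :
    P' {ω | ∃ t, ε < |Z ω t - Z ω (ψ (π t))|} ≤ c := by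
  classical
  obtain ⟨hZm, hZt⟩ := hZt
  have : IsProbabilityMeasure (P'.map Z) := Measure.isProbabilityMeasure_map hZm.aemeasurable
  let U : Finset T → Set (Linf T) := fun S => {z | ∃ t ∈ S, ε < |z t - z (ψ (π t))|}
  have hUopen : ∀ S, IsOpen (U S) := by
    intro S
    have : U S = ⋃ t ∈ S, {z | ε < |z t - z (ψ (π t))|} := by ext z; simp [U]
    rw [this]
    exact isOpen_biUnion fun t _ => isOpen_lt continuous_const
      ((continuous_apply_linf t).sub (continuous_apply_linf _)).abs
  have hUmono : Monotone U := by
    rintro S S' hSS z ⟨t, ht, hlt⟩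
    exact ⟨t, hSS ht, hlt⟩
  have hUc (S : Finset T) : P'.map Z (U S) ≤ c := by
    rcases S.eq_empty_or_nonempty with hS | hS
    · have : U S = ∅ := by simp [U, hS]
      simp [this]
    -- Including the net points of `S` makes `U S` an open cylinder over finitely many coordinates,
    -- so the portmanteau inequality for open sets applies to the marginals.
    obtain ⟨N, ψ', idx, hidx⟩ := exists_fin_enumeration (S ∪ S.image fun t => ψ (π t))
      (hS.mono Finset.subset_union_left)
    have hidx1 : ∀ t ∈ S, ψ' (idx t) = t := fun t ht => hidx t (Finset.mem_union_left _ ht)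
    have hidx2 : ∀ t ∈ S, ψ' (idx (ψ (π t))) = ψ (π t) := fun t ht =>
      hidx _ (Finset.mem_union_right _ (Finset.mem_image_of_mem (fun t => ψ (π t)) ht))
    let G : Set (Fin N → ℝ) := {x | ∃ t ∈ S, ε < |x (idx t) - x (idx (ψ (π t)))|}
    have hG : IsOpen G := by
      have : G = ⋃ t ∈ S, {x | ε < |x (idx t) - x (idx (ψ (π t)))|} := by ext z; simp [G]
      rw [this]
      exact isOpen_biUnion fun t _ => isOpen_lt continuous_const
        ((continuous_apply (idx t)).sub (continuous_apply (idx (ψ (π t))))).abs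
    have hZc : ∀ t, Measurable fun ω => Z ω t := fun t =>
      (continuous_apply_linf t).measurable.comp hZm
    have hmeas := measurable_marginal hZc ψ'
    have hle := ProbabilityMeasure.le_liminf_measure_open_of_tendsto
      (MarginalConv.tendsto_marginalLaw (μ := marginalLaw P' hZc ψ') hZ (hfidi N ψ')) hG
    have e1 : P'.map Z (U S) = (marginalLaw P' hZc ψ' : Measure (Fin N → ℝ)) G := by
      change _ = (P'.map (fun ω l => Z ω (ψ' l) : Ω' → Fin N → ℝ)) G
      rw [Measure.map_apply hZm (hUopen S).measurableSet, Measure.map_apply hmeas hG.measurableSet]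
      congr 1
      ext ω
      simp only [U, G, Set.mem_preimage, Set.mem_ofPred_eq]
      refine exists_congr fun t => and_congr_right fun ht => ?_
      rw [hidx1 t ht, hidx2 t ht]
    rw [e1]
    refine hle.trans (liminf_le_of_frequently_le' (Eventually.frequently ?_))
    filter_upwards [h] with n hn
    refine le_trans ?_ hn
    change (P.map (fun ω l => Zn n ω (ψ' l) : Ω → Fin N → ℝ)) G ≤ _
    rw [Measure.map_apply (measurable_marginal (hZ n) ψ') hG.measurableSet]
    refine measure_mono fun ω hω => ?_
    obtain ⟨t, ht, hlt⟩ := hω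
    beta_reduce at hlt
    rw [hidx1 t ht, hidx2 t ht] at hlt
    exact ⟨t, hlt⟩
  -- Tightness of the limit lifts the bound from finite sets of coordinates to all of `T`.
  have hmain := measure_iUnion_le_of_directed_open hZt hUopen hUmono.directed_le hUc
  rw [Measure.map_apply hZm (isOpen_iUnion hUopen).measurableSet] at hmain
  refine (measure_mono ?_).trans hmain
  rintro ω ⟨t, ht⟩
  exact Set.mem_iUnion.2 ⟨{t}, t, Finset.mem_singleton_self t, ht⟩

theorem measurable_comp_finiteRank {Z : Ω → Linf T} (hZ : ∀ t, Measurable fun ω => Z ω t)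
    {H : Linf T → ℝ} (hH : Continuous H) {k : ℕ} (ψ : Fin k → T) (π : T → Fin k) :
    Measurable fun ω => H (finiteRank π fun l => Z ω (ψ l)) :=
  (hH.comp (continuous_finiteRank π)).measurable.comp
    (measurable_marginal hZ ψ)

theorem exists_pos_mul_lt {D ε : ℝ} (hD : 0 ≤ D) (hε : 0 < ε) : ∃ e : ℝ, 0 < e ∧ D * e < ε := by
  refine ⟨ε / (D + 1), by positivity, ?_⟩
  rw [mul_div_assoc', div_lt_iff₀ (by positivity)]
  nlinarith

/-- Fidi-convergence to a tight limit implies weak convergence for finitely approximable maps. -/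
theorem FinitelyApproximable.weakConv (hap : FinitelyApproximable P Zn)
    (hZ : ∀ n t, Measurable fun ω => Zn n ω t)
    {Ω' : Type*} [MeasurableSpace Ω'] {P' : Measure Ω'} [IsProbabilityMeasure P']
    {Z : Ω' → Linf T} (hZt : IsTightRandomElement P' Z) (hfidi : FidiConv P Zn P' Z) :
    WeakConv P Zn P' Z := by
  have : IsProbabilityMeasure (P'.map Z) := Measure.isProbabilityMeasure_map hZt.1.aemeasurable
  intro H
  rw [← integral_map hZt.1.aemeasurable H.continuous.measurable.aestronglyMeasurable]
  refine tendsto_outerExpectation_of_lipschitz Zn (P'.map Z) ?_ H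
  intro H K B hK hB
  rw [integral_map hZt.1.aemeasurable hK.continuous.measurable.aestronglyMeasurable]
  refine tendsto_coe_of_forall_eventually fun ε hε => ?_
  have hBnn : 0 ≤ B := (abs_nonneg _).trans (hB 0)
  obtain ⟨e, he, hDe⟩ := exists_pos_mul_lt (D := K + 2 * B) (by positivity)
    (by positivity : 0 < ε / 3)
  obtain ⟨k, ψ, π, hev⟩ := hap e he
  have hlimP := measure_exists_lt_le_of_fidiConv hZ hZt hfidi hev
  have hZc : ∀ t, Measurable fun ω => Z ω t := fun t =>
    (continuous_apply_linf t).measurable.comp hZt.1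
  have hA := outerExpectation_approx hK hB
    (measurable_comp_finiteRank hZc hK.continuous ψ π) he.le
    (measure_lt_dist_finiteRank_le he.le hlimP)
  have hHZm : Measurable fun ω => H (Z ω) := hK.continuous.measurable.comp hZt.1
  have hHZ : Integrable (fun ω => H (Z ω)) P' :=
    Integrable.of_bound hHZm.aestronglyMeasurable B (Eventually.of_forall fun ω => hB _)
  -- `Z` is measurable, so the outer expectation in `hA` is squeezed onto the integral of `H (Z ω)`.
  -- The budget is `ε / 3` each for replacing `Z`, for replacing `Zn`, and for fidi-convergence.
  have hA1 := hA.1.trans (outerExpectation_le_integral hHZm hHZ fun ω => le_rfl)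
  have hA2 := (integral_le_outerExpectation hHZ fun ω => le_rfl).trans hA.2
  rw [EReal.coe_le_coe_iff] at hA1 hA2
  have hlim := (hfidi k ψ).tendsto_integral_finiteRank (π := π) hK.continuous hB
  have hmap : ∫ x, H (finiteRank π x) ∂(P'.map (fun ω l => Z ω (ψ l) : Ω' → Fin k → ℝ)) =
      ∫ ω, H (finiteRank π fun l => Z ω (ψ l)) ∂P' :=
    integral_map (measurable_marginal hZc ψ).aemeasurable
      (hK.continuous.comp (continuous_finiteRank π)).measurable.aestronglyMeasurable
  rw [hmap] at hlim
  filter_upwards [hev, Metric.tendsto_nhds.1 hlim (ε / 3) (by positivity)] with n hn hd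
  have hAn := outerExpectation_approx hK hB
    (measurable_comp_finiteRank (hZ n) hK.continuous ψ π) he.le
    (measure_lt_dist_finiteRank_le he.le hn)
  rw [Real.dist_eq, abs_lt] at hd
  refine ⟨le_trans ?_ hAn.1, hAn.2.trans ?_⟩
  · exact EReal.coe_le_coe_iff.2 (by linarith [hd.1])
  · exact EReal.coe_le_coe_iff.2 (by linarith [hd.2])

end FiniteRank

/-! ### Existence of a tight weak limit. -/

section Existence

variable {T Ω : Type*} [MeasurableSpace Ω] {P : Measure Ω} [IsProbabilityMeasure P]
  {Zn : ℕ → Ω → Linf T}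

/-- A convergent sequence together with its limit is compact, so by Prokhorov's theorem on `ℝ^k` the
laws are uniformly tight and one compact set serves all `n`. -/
theorem MarginalConv.exists_isCompact (hZ : ∀ n t, Measurable fun ω => Zn n ω t)
    {k : ℕ} {ψ : Fin k → T} {μ : Measure (Fin k → ℝ)} [IsProbabilityMeasure μ]
    (h : MarginalConv P Zn ψ μ) {c : ℝ≥0∞} (hc : 0 < c) :
    ∃ C : Set (Fin k → ℝ), IsCompact C ∧
      ∀ n, P {ω | (fun l => Zn n ω (ψ l) : Fin k → ℝ) ∉ C} ≤ c := by
  have hlim := MarginalConv.tendsto_marginalLaw (μ := ⟨μ, inferInstance⟩) hZ h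
  have hcl : IsCompact (closure (Set.range fun n => marginalLaw P (hZ n) ψ)) :=
    (hlim.isCompact_insert_range).closure_of_subset (Set.subset_insert _ _)
  obtain ⟨C, hC, hCμ⟩ := isTightMeasureSet_iff_exists_isCompact_measure_compl_le.1
    (isTightMeasureSet_of_isCompact_closure hcl) c hc
  refine ⟨C, hC, fun n => ?_⟩
  have := hCμ _ ⟨_, ⟨n, rfl⟩, rfl⟩
  change (P.map (fun ω l => Zn n ω (ψ l) : Ω → Fin k → ℝ)) Cᶜ ≤ c at this
  rwa [Measure.map_apply (measurable_marginal (hZ n) ψ) hC.measurableSet.compl] at this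

/-- Every sequence in a uniformly tight family of probability measures has a tight limit along the
ultrafilter `hyperfilter ℕ`. -/
theorem exists_tendsto_hyperfilter_of_isTightMeasureSet {E : Type*} [MetricSpace E]
    [MeasurableSpace E] [BorelSpace E] (L : ℕ → ProbabilityMeasure E)
    (hL : IsTightMeasureSet (Set.range fun m => (L m : Measure E))) :
    ∃ L' : ProbabilityMeasure E, IsTightMeasureSet {(L' : Measure E)} ∧
      Tendsto L (hyperfilter ℕ) (𝓝 L') := by
  rw [isTightMeasureSet_iff_exists_isCompact_measure_compl_le] at hL
  obtain ⟨u, -, hupos, hulim⟩ := exists_seq_strictAnti_tendsto (0 : NNReal)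
  choose K hK hKL using fun i => hL (u i) (by exact_mod_cast hupos i)
  -- Prokhorov: the probability measures giving mass at most `u i` to the complement of `K i`, for
  -- all `i`, form a compact set. The limit stays in it and hence is tight.
  have hcomp := isCompact_setOfPred_probabilityMeasure_mass_eq_compl_isCompact_le hulim hK
    (Or.inl inferInstance)
  obtain ⟨L', hL', hlim⟩ := hcomp.ultrafilter_le_nhds ((hyperfilter ℕ).map L) (by
    rw [le_principal_iff]
    refine Ultrafilter.mem_map.2 (Eventually.of_forall fun m i => ?_)
    have := hKL i _ ⟨m, rfl⟩
    rw [← ENNReal.coe_le_coe]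
    simpa using this)
  refine ⟨L', ?_, hlim⟩
  rw [isTightMeasureSet_iff_exists_isCompact_measure_compl_le]
  intro ε hε
  have hulim' : Tendsto (fun i => (u i : ℝ≥0∞)) atTop (𝓝 0) := by
    rw [← ENNReal.coe_zero]
    exact ENNReal.tendsto_coe.2 hulim
  obtain ⟨i, hi⟩ := (hulim'.eventually_lt_const hε).exists
  refine ⟨K i, hK i, ?_⟩
  rintro _ rfl
  have := ENNReal.coe_le_coe.2 (hL' i)
  simp only [ProbabilityMeasure.ennreal_coeFn_eq_coeFn_toMeasure] at this
  exact this.trans hi.le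

/-- The finite-rank approximations of a finitely approximable sequence, taken along a fast
subsequence, have a tight sequence of laws. -/
theorem isTightMeasureSet_map_finiteRank (hZ : ∀ n t, Measurable fun ω => Zn n ω t)
    (hfidi : FidiConvergent P Zn) {e : ℕ → ℝ} (he : ∀ m, 0 < e m) (hanti : Antitone e)
    (helim : Tendsto e atTop (𝓝 0)) {k : ℕ → ℕ} {ψ : ∀ m, Fin (k m) → T}
    {π : ∀ m, T → Fin (k m)} {N : ℕ → ℕ}
    (hap : ∀ m n, N m ≤ n →
      P {ω | ∃ t, e m < |Zn n ω t - Zn n ω (ψ m (π m t))|} ≤ ENNReal.ofReal (e m))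
    {σ : ℕ → ℕ} (hσ : ∀ j m, j ≤ m → N j ≤ σ m) :
    IsTightMeasureSet
      (Set.range fun m => P.map fun ω => finiteRank (π m) fun l => Zn (σ m) ω (ψ m l)) := by
  have hYm : ∀ m, Measurable fun ω => finiteRank (π m) fun l => Zn (σ m) ω (ψ m l) := fun m =>
    (continuous_finiteRank (π m)).measurable.comp (measurable_marginal (hZ (σ m)) (ψ m))
  refine isTightMeasureSet_of_cthickening fun ε hε => ?_
  obtain ⟨j, hj⟩ := (helim.eventually_lt_const (by positivity : (0 : ℝ) < ε / 3)).exists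
  obtain ⟨μ, hμ, hμlim⟩ := hfidi (k j) (ψ j)
  obtain ⟨C, hC, hCP⟩ := hμlim.exists_isCompact hZ
    (c := ENNReal.ofReal (e j)) (ENNReal.ofReal_pos.2 (he j))
  -- `Linf T` need not be separable, so tightness of a single law is pushed forward from `ℝ^k`. It
  -- handles the finitely many `m < j`; for `m ≥ j` both approximations are close to `Zn (σ m)`,
  -- hence to each other, and the one of level `j` mostly lies in the compact image of `C`.
  have hsmall : ∀ m, ∃ D : Set (Linf T), IsCompact D ∧
      (P.map fun ω => finiteRank (π m) fun l => Zn (σ m) ω (ψ m l)) Dᶜ ≤ ENNReal.ofReal ε := by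
    intro m
    have h1 : IsTightMeasureSet {P.map (fun ω l => Zn (σ m) ω (ψ m l) : Ω → Fin (k m) → ℝ)} :=
      isTightMeasureSet_singleton
    obtain ⟨D, hD, hDP⟩ := isTightMeasureSet_iff_exists_isCompact_measure_compl_le.1
      (h1.map (continuous_finiteRank (π m))) _ (ENNReal.ofReal_pos.2 hε)
    refine ⟨D, hD, ?_⟩
    have := hDP _ ⟨_, rfl, rfl⟩
    rwa [Measure.map_map (continuous_finiteRank (π m)).measurable
      (measurable_marginal (hZ (σ m)) (ψ m))] at this
  choose D hD hDP using hsmall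
  refine ⟨(⋃ m ∈ Finset.range j, D m) ∪ finiteRank (π j) '' C,
    ((Finset.range j).isCompact_biUnion fun m _ => hD m).union
      (hC.image (continuous_finiteRank (π j))), ?_⟩
  rintro _ ⟨m, rfl⟩
  rcases lt_or_ge m j with hmj | hjm
  · refine (measure_mono (Set.compl_subset_compl.2 ?_)).trans (hDP m)
    refine Set.Subset.trans (fun x hx => Or.inl ?_) (Metric.self_subset_cthickening _)
    exact Set.mem_biUnion (Finset.mem_coe.2 (Finset.mem_range.2 hmj)) hx
  · rw [Measure.map_apply (hYm m) Metric.isClosed_cthickening.measurableSet.compl]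
    have hem : e m ≤ e j := hanti hjm
    have h1 := measure_lt_dist_finiteRank_le (he m).le (hap m (σ m) (hσ m m le_rfl))
    have h2 := measure_lt_dist_finiteRank_le (he j).le (hap j (σ m) (hσ j m hjm))
    calc _ ≤ P ({ω | e m < dist (Zn (σ m) ω) (finiteRank (π m) fun l => Zn (σ m) ω (ψ m l))} ∪
          {ω | e j < dist (Zn (σ m) ω) (finiteRank (π j) fun l => Zn (σ m) ω (ψ j l))} ∪
          {ω | (fun l => Zn (σ m) ω (ψ j l) : Fin (k j) → ℝ) ∉ C}) := by
          refine measure_mono fun ω hω => ?_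
          by_contra hcon
          simp only [Set.mem_union, Set.mem_ofPred_eq, not_or, not_lt, not_not] at hcon
          obtain ⟨⟨c1, c2⟩, c3⟩ := hcon
          refine hω (Metric.mem_cthickening_of_dist_le _ _ _ _
            (Or.inr (Set.mem_image_of_mem _ c3)) ?_)
          refine (dist_triangle_left _ _ (Zn (σ m) ω)).trans ?_
          linarith
      _ ≤ ENNReal.ofReal (e m) + ENNReal.ofReal (e j) + ENNReal.ofReal (e j) :=
          (measure_union_le _ _).trans
            (add_le_add ((measure_union_le _ _).trans (add_le_add h1 h2)) (hCP _))
      _ ≤ ENNReal.ofReal ε := by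
          rw [← ENNReal.ofReal_add (he m).le (he j).le,
            ← ENNReal.ofReal_add (add_nonneg (he m).le (he j).le) (he j).le]
          exact ENNReal.ofReal_le_ofReal (by linarith)

/-- A finitely approximable sequence all of whose marginals converge has a tight weak limit. -/
theorem FinitelyApproximable.exists_weakConv (hap : FinitelyApproximable P Zn)
    (hZ : ∀ n t, Measurable fun ω => Zn n ω t) (hfidi : FidiConvergent P Zn) :
    ∃ L : Measure (Linf T), IsProbabilityMeasure L ∧ IsTightMeasureSet {L} ∧
      WeakConv P Zn L id := by
  set e : ℕ → ℝ := fun m => 1 / ((m : ℝ) + 1) with he_def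
  have he : ∀ m, 0 < e m := fun m => by positivity
  have hanti : Antitone e := fun a b hab => by
    simp only [he_def]
    gcongr
  have helim : Tendsto e atTop (𝓝 0) := tendsto_one_div_add_atTop_nhds_zero_nat
  choose k ψ π hev using fun m => hap (e m) (he m)
  choose N hN using fun m => eventually_atTop.1 (hev m)
  -- At time `σ m` the approximations of all levels `j ≤ m` are valid simultaneously, and `σ` tends
  -- to infinity.
  set σ : ℕ → ℕ := fun m => m + ∑ j ∈ Finset.range (m + 1), N j with hσ_def
  have hσ : ∀ j m, j ≤ m → N j ≤ σ m := fun j m hjm =>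
    (Finset.single_le_sum (f := N) (fun _ _ => Nat.zero_le _)
      (Finset.mem_range.2 (Nat.lt_succ_of_le hjm))).trans (Nat.le_add_left _ _)
  have hσlim : Tendsto σ atTop atTop :=
    tendsto_atTop_mono (fun m => Nat.le_add_right m _) tendsto_id
  have hYm : ∀ m, Measurable fun ω => finiteRank (π m) fun l => Zn (σ m) ω (ψ m l) := fun m =>
    (continuous_finiteRank (π m)).measurable.comp (measurable_marginal (hZ (σ m)) (ψ m))
  obtain ⟨L, hLt, hLlim⟩ := exists_tendsto_hyperfilter_of_isTightMeasureSet
    (fun m => ⟨P.map fun ω => finiteRank (π m) fun l => Zn (σ m) ω (ψ m l),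
      Measure.isProbabilityMeasure_map (hYm m).aemeasurable⟩)
    (isTightMeasureSet_map_finiteRank hZ hfidi he hanti helim hN hσ)
  refine ⟨L, inferInstance, hLt, fun H => ?_⟩
  refine tendsto_outerExpectation_of_lipschitz Zn (L : Measure (Linf T)) ?_ H
  intro H K B hK hB
  have hBnn : 0 ≤ B := (abs_nonneg _).trans (hB 0)
  have hHlim : Tendsto (fun m => ∫ ω, H (finiteRank (π m) fun l => Zn (σ m) ω (ψ m l)) ∂P)
      (hyperfilter ℕ) (𝓝 (∫ x, H x ∂(L : Measure (Linf T)))) := by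
    have := ProbabilityMeasure.tendsto_iff_forall_integral_tendsto.1 hLlim
      (BoundedContinuousFunction.ofNormedAddCommGroup H hK.continuous B fun x => hB x)
    refine this.congr fun m => ?_
    exact integral_map (hYm m).aemeasurable hK.continuous.measurable.aestronglyMeasurable
  have happ : ∀ m n, N m ≤ n → _ := fun m n hmn => outerExpectation_approx hK hB
    (measurable_comp_finiteRank (hZ n) hK.continuous (ψ m) (π m)) (he m).le
    (measure_lt_dist_finiteRank_le (he m).le (hN m n hmn))
  refine tendsto_coe_of_forall_eventually fun ε hε => ?_
  obtain ⟨d, hd, hDd⟩ := exists_pos_mul_lt (D := K + 2 * B) (by positivity)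
    (by positivity : 0 < ε / 5)
  obtain ⟨j, hj⟩ := (helim.eventually_lt_const hd).exists
  have hDe : ∀ m, j ≤ m → (K + 2 * B) * e m ≤ ε / 5 := fun m hm =>
    (mul_le_mul_of_nonneg_left ((hanti hm).trans hj.le) (by positivity)).trans hDd.le
  obtain ⟨μ, hμ, hμlim⟩ := hfidi (k j) (ψ j)
  set y := ∫ x, H (finiteRank (π j) x) ∂μ with hy
  have hlim := Metric.tendsto_nhds.1
    (hμlim.tendsto_integral_finiteRank (π := π j) hK.continuous hB) (ε / 5) (by positivity)
  have hmid : ∀ᶠ n in atTop,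
      ((y - 2 * (ε / 5) : ℝ) : EReal) ≤ outerExpectation P (fun ω => (H (Zn n ω) : EReal)) ∧
      outerExpectation P (fun ω => (H (Zn n ω) : EReal)) ≤ ((y + 2 * (ε / 5) : ℝ) : EReal) := by
    filter_upwards [hlim, eventually_ge_atTop (N j)] with n hn hjn
    rw [Real.dist_eq, abs_lt] at hn
    have := hDe j le_rfl
    exact ⟨le_trans (EReal.coe_le_coe_iff.2 (by linarith [hn.1])) (happ j n hjn).1,
      (happ j n hjn).2.trans (EReal.coe_le_coe_iff.2 (by linarith [hn.2]))⟩
  have hclose : ∀ᶠ m in atTop,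
      ∫ ω, H (finiteRank (π m) fun l => Zn (σ m) ω (ψ m l)) ∂P ∈
        Set.Icc (y - 3 * (ε / 5)) (y + 3 * (ε / 5)) := by
    filter_upwards [hσlim.eventually hmid, eventually_ge_atTop j] with m hm hjm
    have h1 := (happ m (σ m) (hσ m m le_rfl)).1.trans hm.2
    have h2 := hm.1.trans (happ m (σ m) (hσ m m le_rfl)).2
    rw [EReal.coe_le_coe_iff] at h1 h2
    have := hDe m hjm
    exact ⟨by linarith, by linarith⟩
  -- The number `y` is within `2ε/5` of the outer expectations for all large `n`, and within `3ε/5`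
  -- of the limit taken along `σ` and the ultrafilter. Comparison through `y` gives convergence of
  -- the full sequence.
  have hmem := isClosed_Icc.mem_of_tendsto hHlim
    (Nat.hyperfilter_le_atTop hclose)
  filter_upwards [hmid] with n hn
  exact ⟨le_trans (EReal.coe_le_coe_iff.2 (by linarith [hmem.2])) hn.1,
    hn.2.trans (EReal.coe_le_coe_iff.2 (by linarith [hmem.1]))⟩

end Existence

/-! ### A maximal inequality -/

/-- Bounding the power of the maximum by the sum of the powers costs `2 ^ (1 / ν)`; the triangle
inequality would cost `2`, too much for the dyadic recursion. -/
theorem lintegral_rpow_sup_le {Ω : Type*} [MeasurableSpace Ω] {P : Measure Ω} {ν : ℝ}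
    (hν : 0 < ν) {f g : Ω → ℝ≥0∞} (hf : Measurable f) {c : ℝ≥0∞}
    (hfc : ∫⁻ ω, f ω ^ ν ∂P ≤ c ^ ν) (hgc : ∫⁻ ω, g ω ^ ν ∂P ≤ c ^ ν) :
    ∫⁻ ω, (f ω ⊔ g ω) ^ ν ∂P ≤ (2 ^ (1 / ν) * c) ^ ν := by
  calc ∫⁻ ω, (f ω ⊔ g ω) ^ ν ∂P ≤ ∫⁻ ω, (f ω ^ ν + g ω ^ ν) ∂P := by
        refine lintegral_mono fun ω => ?_
        rcases le_total (f ω) (g ω) with h | h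
        · simp [sup_of_le_right h]
        · simp [sup_of_le_left h]
    _ = ∫⁻ ω, f ω ^ ν ∂P + ∫⁻ ω, g ω ^ ν ∂P := lintegral_add_left (hf.pow_const ν) _
    _ ≤ c ^ ν + c ^ ν := add_le_add hfc hgc
    _ = (2 ^ (1 / ν) * c) ^ ν := by
        rw [ENNReal.mul_rpow_of_nonneg _ _ hν.le, ← ENNReal.rpow_mul, one_div_mul_cancel hν.ne',
          ENNReal.rpow_one, two_mul]

theorem lintegral_rpow_add_le {Ω : Type*} [MeasurableSpace Ω] {P : Measure Ω} {ν : ℝ}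
    (hν : 1 ≤ ν) {f g : Ω → ℝ≥0∞} (hf : Measurable f) (hg : Measurable g) {a b : ℝ≥0∞}
    (hfa : ∫⁻ ω, f ω ^ ν ∂P ≤ a ^ ν) (hgb : ∫⁻ ω, g ω ^ ν ∂P ≤ b ^ ν) :
    ∫⁻ ω, (f ω + g ω) ^ ν ∂P ≤ (a + b) ^ ν := by
  have hν0 : 0 < ν := by linarith
  have key := ENNReal.lintegral_Lp_add_le (μ := P) hf.aemeasurable hg.aemeasurable hν
  have hroot : ∀ {x y : ℝ≥0∞}, x ≤ y ^ ν → x ^ (1 / ν) ≤ y := fun {x y} h => by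
    calc x ^ (1 / ν) ≤ (y ^ ν) ^ (1 / ν) := ENNReal.rpow_le_rpow h (by positivity)
      _ = y := by rw [← ENNReal.rpow_mul, mul_one_div_cancel hν0.ne', ENNReal.rpow_one]
  have h2 := key.trans (add_le_add (hroot hfa) (hroot hgb))
  calc _ = ((∫⁻ ω, (f ω + g ω) ^ ν ∂P) ^ (1 / ν)) ^ ν := by
        rw [← ENNReal.rpow_mul, one_div_mul_cancel hν0.ne', ENNReal.rpow_one]
    _ ≤ (a + b) ^ ν := ENNReal.rpow_le_rpow h2 hν0.le

/-- Dyadic maximal inequality: moment bounds for the increments over blocks of length `m` yield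
moment bounds for the maximal increment over blocks of length `2 ^ p`. -/
theorem exists_dyadic_majorant {Ω Φ : Type*} [MeasurableSpace Ω] {P : Measure Ω} {ν : ℝ}
    (hν : 1 ≤ ν) {s : Φ → ℕ → Ω → ℝ} {G : ℕ → ℝ≥0∞}
    (hW : ∀ a m, 1 ≤ m → ∃ W : Ω → ℝ≥0∞, Measurable W ∧
      (∀ φ ω, ENNReal.ofReal |s φ (a + m) ω - s φ a ω| ≤ W ω) ∧ ∫⁻ ω, W ω ^ ν ∂P ≤ G m ^ ν)
    {K : ℝ≥0∞} (hK : 1 ≤ K)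
    (hG : ∀ p, G (2 ^ p) + 2 ^ (1 / ν) * (K * G (2 ^ p)) ≤ K * G (2 ^ (p + 1))) (p a : ℕ) :
    ∃ M : Ω → ℝ≥0∞, Measurable M ∧
      (∀ φ ω, ∀ k ≤ 2 ^ p, ENNReal.ofReal |s φ (a + k) ω - s φ a ω| ≤ M ω) ∧
      ∫⁻ ω, M ω ^ ν ∂P ≤ (K * G (2 ^ p)) ^ ν := by
  have hν0 : 0 < ν := by linarith
  induction p generalizing a with
  | zero =>
    obtain ⟨W, hWm, hWle, hWint⟩ := hW a 1 le_rfl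
    refine ⟨W, hWm, fun φ ω k hk => ?_, hWint.trans ?_⟩
    · rw [pow_zero] at hk
      rcases Nat.le_one_iff_eq_zero_or_eq_one.1 hk with rfl | rfl
      · simp
      · exact hWle φ ω
    · rw [pow_zero]
      exact ENNReal.rpow_le_rpow (le_mul_of_one_le_left' hK) hν0.le
  | succ p ih =>
    obtain ⟨W, hWm, hWle, hWint⟩ := hW a (2 ^ p) Nat.one_le_two_pow
    obtain ⟨M₁, hM₁, hle₁, hint₁⟩ := ih a
    obtain ⟨M₂, hM₂, hle₂, hint₂⟩ := ih (a + 2 ^ p)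
    -- An endpoint in the second half is reached by the full first half (`W`) and then an increment
    -- inside the second half (`M₂`).
    refine ⟨fun ω => W ω + (M₁ ω ⊔ M₂ ω), hWm.add (hM₁.sup hM₂), fun φ ω k hk => ?_, ?_⟩
    · rcases le_total k (2 ^ p) with h | h
      · exact (hle₁ φ ω k h).trans (le_sup_left.trans le_add_self)
      · obtain ⟨l, rfl⟩ := Nat.exists_eq_add_of_le h
        have hl : l ≤ 2 ^ p := by rw [pow_succ] at hk; omega
        have h2 := hle₂ φ ω l hl
        rw [add_assoc] at h2
        calc ENNReal.ofReal |s φ (a + (2 ^ p + l)) ω - s φ a ω|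
            ≤ ENNReal.ofReal (|s φ (a + 2 ^ p) ω - s φ a ω| +
                |s φ (a + (2 ^ p + l)) ω - s φ (a + 2 ^ p) ω|) := by
              refine ENNReal.ofReal_le_ofReal ?_
              have := abs_sub_le (s φ (a + (2 ^ p + l)) ω) (s φ (a + 2 ^ p) ω) (s φ a ω)
              linarith
          _ = _ := ENNReal.ofReal_add (abs_nonneg _) (abs_nonneg _)
          _ ≤ W ω + (M₁ ω ⊔ M₂ ω) := add_le_add (hWle φ ω) (h2.trans le_sup_right)
    · refine (lintegral_rpow_add_le hν hWm (hM₁.sup hM₂) hWint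
        (lintegral_rpow_sup_le hν0 hM₁ hint₁ hint₂)).trans ?_
      exact ENNReal.rpow_le_rpow (hG p) hν0.le

/-- The constant in the maximal inequality for moment bounds of order `ν` that grow like `m ^ a`. -/
def maxConst (a ν : ℝ) : ℝ := max 1 (1 / (2 ^ (a / 2) - 2 ^ (1 / ν)))

theorem one_le_maxConst (a ν : ℝ) : 1 ≤ maxConst a ν := le_max_left _ _

/-- This is the induction step of the dyadic recursion, solvable because `1 / ν < a / 2`. The lower
bound `1` in `maxConst` serves the base case. -/
theorem maxConst_spec {a ν : ℝ} (ha : 2 / ν < a) :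
    1 + 2 ^ (1 / ν) * maxConst a ν ≤ 2 ^ (a / 2) * maxConst a ν := by
  have hlt : (2 : ℝ) ^ (1 / ν) < 2 ^ (a / 2) := by
    refine Real.rpow_lt_rpow_of_exponent_lt one_lt_two ?_
    have : 2 / ν = 2 * (1 / ν) := by ring
    linarith
  have h := le_max_right 1 (1 / ((2 : ℝ) ^ (a / 2) - 2 ^ (1 / ν)))
  rw [div_le_iff₀ (sub_pos.2 hlt)] at h
  change 1 ≤ maxConst a ν * _ at h
  linarith

/-! ### The maximal inequality for partial sums. -/

section Blocks

variable {Ω 𝒳 : Type*} [MeasurableSpace Ω] {P : Measure Ω} {X : ℕ → ℕ → Ω → 𝒳}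

theorem partialSum_sub_partialSum {n a b : ℕ} (hab : a ≤ b) (φ : 𝒳 → ℝ) (ω : Ω) :
    partialSum P X n 1 b φ ω - partialSum P X n 1 a φ ω = partialSum P X n (a + 1) b φ ω := by
  have h : ∀ c d : ℕ, Finset.Icc (c + 1) d = Finset.Ioc c d := fun c d => by
    ext x; simp
  have h1 := Finset.sum_Ioc_consecutive (fun k => centered P X n k φ ω) (Nat.zero_le a) hab
  simp only [partialSum, h, ← h1]
  ring

theorem exists_measurable_majorant_partialSum {𝓖 : Set (𝒳 → ℝ)} {ν c : ℝ} (hν : 0 < ν)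
    (hne : 𝓖.Nonempty) (hc : 0 ≤ c) {n i j : ℕ}
    (h : supMoment P X 𝓖 ν n i j ≤ ((c ^ (ν / 2) : ℝ) : EReal)) :
    ∃ W : Ω → ℝ≥0∞, Measurable W ∧
      (∀ φ ∈ 𝓖, ∀ ω, ENNReal.ofReal |partialSum P X n i j φ ω| ≤ W ω) ∧
      ∫⁻ ω, W ω ^ ν ∂P ≤ ENNReal.ofReal (√c) ^ ν := by
  -- Nonnegativity of the supremum uses `hne`: over an empty class it would be `⊥`.
  obtain ⟨U, hU, hle, hint⟩ := exists_measurable_majorant (fun ω => by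
    obtain ⟨φ, hφ⟩ := hne
    refine le_trans ?_ (le_iSup₂ (f := fun (φ : 𝒳 → ℝ) (_ : φ ∈ 𝓖) =>
      ((|partialSum P X n i j φ ω| ^ ν : ℝ) : EReal)) φ hφ)
    exact_mod_cast Real.rpow_nonneg (abs_nonneg _) ν) h
  refine ⟨fun ω => U ω ^ (1 / ν), hU.pow_const _, fun φ hφ ω => ?_, ?_⟩
  · have h1 := (EReal.toENNReal_le_toENNReal (le_iSup₂ (f := fun (φ : 𝒳 → ℝ) (_ : φ ∈ 𝓖) =>
      ((|partialSum P X n i j φ ω| ^ ν : ℝ) : EReal)) φ hφ)).trans (hle ω)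
    rw [EReal.real_coe_toENNReal, ← ENNReal.ofReal_rpow_of_nonneg (abs_nonneg _) hν.le] at h1
    calc _ = (ENNReal.ofReal |partialSum P X n i j φ ω| ^ ν) ^ (1 / ν) := by
          rw [← ENNReal.rpow_mul, mul_one_div_cancel hν.ne', ENNReal.rpow_one]
      _ ≤ _ := ENNReal.rpow_le_rpow h1 (by positivity)
  · simp only [← ENNReal.rpow_mul, one_div_mul_cancel hν.ne', ENNReal.rpow_one]
    refine hint.trans_eq ?_
    rw [ENNReal.ofReal_rpow_of_nonneg (Real.sqrt_nonneg c) hν.le, Real.sqrt_eq_rpow,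
      ← Real.rpow_mul hc]
    ring_nf

/-- Maximal inequality for the partial sums, uniform over a class of functions. -/
theorem measure_exists_le_abs_partialSum_le {𝓖 : Set (𝒳 → ℝ)} (hne : 𝓖.Nonempty) {a ν : ℝ}
    (hν : 1 ≤ ν) (ha : 2 / ν < a) {Γ : ℕ → ℝ} (hΓ0 : ∀ m, 0 ≤ Γ m)
    (hΓ : ∀ i j, 1 ≤ i → i ≤ j → Γ i ≤ ((i : ℝ) / j) ^ a * Γ j) {n : ℕ}
    (hmom : ∀ i j, 1 ≤ i → i ≤ j → j ≤ n →
      supMoment P X 𝓖 ν n i j ≤ ((Γ (j - i + 1) ^ (ν / 2) : ℝ) : EReal))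
    (p b : ℕ) {x : ℝ} (hx : 0 < x) :
    P {ω | ∃ φ ∈ 𝓖, ∃ k ≤ 2 ^ p, x ≤
        |partialSum P X n 1 (min (b + k) n) φ ω - partialSum P X n 1 (min b n) φ ω|} ≤
      ENNReal.ofReal ((maxConst a ν * √(Γ (2 ^ p)) / x) ^ ν) := by
  have hν0 : 0 < ν := by linarith
  have ha0 : 0 ≤ a := (by positivity : 0 ≤ 2 / ν).trans ha.le
  have hΓmono : ∀ i j, 1 ≤ i → i ≤ j → Γ i ≤ Γ j := fun i j hi hij => by
    refine (hΓ i j hi hij).trans (mul_le_of_le_one_left (hΓ0 j) ?_)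
    refine Real.rpow_le_one (by positivity) ?_ ha0
    exact div_le_one_of_le₀ (by exact_mod_cast hij) (by positivity)
  have hK0 : 0 ≤ maxConst a ν := zero_le_one.trans (one_le_maxConst a ν)
  -- The moment bounds stop at `n`, so the partial sums are frozen there. Frozen increments vanish,
  -- and truncated blocks are shorter and are covered by monotonicity of `Γ`.
  obtain ⟨M, hM, hMle, hMint⟩ := exists_dyadic_majorant (P := P) hν
    (s := fun (φ : 𝓖) k ω => partialSum P X n 1 (min k n) φ ω)
    (G := fun m => ENNReal.ofReal √(Γ m)) (K := ENNReal.ofReal (maxConst a ν)) (by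
      intro c m hm
      rcases le_or_gt n c with hnc | hcn
      · refine ⟨0, measurable_zero, fun φ ω => ?_, ?_⟩
        · simp [min_eq_right hnc, min_eq_right (hnc.trans (Nat.le_add_right c m))]
        · simp [hν0]
      · have hle : c + 1 ≤ min (c + m) n := le_min (by omega) hcn
        obtain ⟨W, hW, hWle, hWint⟩ := exists_measurable_majorant_partialSum hν0 hne
          (hΓ0 _) (hmom (c + 1) (min (c + m) n) (by omega) hle (min_le_right _ _))
        refine ⟨W, hW, fun φ ω => ?_, hWint.trans ?_⟩
        · rw [min_eq_left hcn.le, partialSum_sub_partialSum (by omega)]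
          exact hWle φ φ.2 ω
        · refine ENNReal.rpow_le_rpow (ENNReal.ofReal_le_ofReal (Real.sqrt_le_sqrt
            (hΓmono _ _ (by omega) ?_))) hν0.le
          have := min_le_left (c + m) n
          omega)
    (by simpa using ENNReal.ofReal_le_ofReal (one_le_maxConst a ν))
    (by
      intro q
      have h2 : Γ (2 ^ q) ≤ ((1 : ℝ) / 2) ^ a * Γ (2 ^ (q + 1)) := by
        have := hΓ (2 ^ q) (2 ^ (q + 1)) Nat.one_le_two_pow
          (Nat.pow_le_pow_right two_pos (Nat.le_succ q))
        have e : (((2 ^ q : ℕ) : ℝ) / ((2 ^ (q + 1) : ℕ) : ℝ)) = 1 / 2 := by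
          push_cast
          rw [pow_succ]
          field_simp
        rwa [e] at this
      -- The gain from doubling, to be set against the loss `2 ^ (1 / ν)` through `maxConst_spec`.
      have h3 : (2 : ℝ) ^ (a / 2) * √(Γ (2 ^ q)) ≤ √(Γ (2 ^ (q + 1))) := by
        refine Real.le_sqrt_of_sq_le ?_
        rw [mul_pow, Real.sq_sqrt (hΓ0 _), ← Real.rpow_natCast, ← Real.rpow_mul two_pos.le]
        have e : a / 2 * ((2 : ℕ) : ℝ) = a := by push_cast; ring
        rw [e]
        rw [one_div, Real.inv_rpow two_pos.le] at h2
        calc (2 : ℝ) ^ a * Γ (2 ^ q) ≤ 2 ^ a * ((2 ^ a)⁻¹ * Γ (2 ^ (q + 1))) := by gcongr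
          _ = Γ (2 ^ (q + 1)) := by
            rw [mul_inv_cancel_left₀ (by positivity)]
      have e2 : (2 : ℝ≥0∞) ^ (1 / ν) = ENNReal.ofReal (2 ^ (1 / ν)) := by
        rw [← ENNReal.ofReal_rpow_of_pos two_pos, ENNReal.ofReal_ofNat]
      rw [e2, ← ENNReal.ofReal_mul hK0, ← ENNReal.ofReal_mul (by positivity),
        ← ENNReal.ofReal_add (Real.sqrt_nonneg _) (by positivity), ← ENNReal.ofReal_mul hK0]
      refine ENNReal.ofReal_le_ofReal ?_
      have h4 := mul_le_mul_of_nonneg_right (maxConst_spec ha) (Real.sqrt_nonneg (Γ (2 ^ q)))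
      have h5 := mul_le_mul_of_nonneg_left h3 hK0
      linarith) p b
  have hxν : ENNReal.ofReal x ^ ν ≠ 0 := by
    rw [ENNReal.ofReal_rpow_of_pos hx]
    simpa using Real.rpow_pos_of_pos hx ν
  have hxν' : ENNReal.ofReal x ^ ν ≠ ∞ := ENNReal.rpow_ne_top_of_nonneg hν0.le ENNReal.ofReal_ne_top
  calc _ ≤ P {ω | ENNReal.ofReal x ^ ν ≤ M ω ^ ν} := by
        refine measure_mono ?_
        rintro ω ⟨φ, hφ, k, hk, hxk⟩
        exact ENNReal.rpow_le_rpow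
          ((ENNReal.ofReal_le_ofReal hxk).trans (hMle ⟨φ, hφ⟩ ω k hk)) hν0.le
    _ ≤ (∫⁻ ω, M ω ^ ν ∂P) / ENNReal.ofReal x ^ ν :=
        meas_ge_le_lintegral_div (hM.pow_const ν).aemeasurable hxν hxν'
    _ ≤ (ENNReal.ofReal (maxConst a ν) * ENNReal.ofReal √(Γ (2 ^ p))) ^ ν /
          ENNReal.ofReal x ^ ν := by gcongr
    _ = _ := by
        rw [← ENNReal.ofReal_mul hK0, ← ENNReal.div_rpow_of_nonneg _ _ hν0.le,
          ← ENNReal.ofReal_div_of_pos hx, ENNReal.ofReal_rpow_of_nonneg (by positivity) hν0.le]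

end Blocks

/-! ### The bound `γ` -/

section Gamma

variable {C κ : ℝ} {R J : ℝ → ℝ} {δ : ℝ}

theorem gammaBound_nonneg (hC : 0 ≤ C) (m : ℕ) : 0 ≤ gammaBound C κ R J m δ := by
  unfold gammaBound
  positivity

/-- With `u = i / j ≤ 1`, the `J` term scales exactly by `u ^ (-κ)` and the `R` term is only
enlarged by this factor; squaring and the linear factor `u` give the exponent `1 - 2κ`. -/
theorem gammaBound_le_rpow_mul (hC : 0 ≤ C) (hκ : 0 ≤ κ) (hR : 0 ≤ R δ) (hJ : 0 ≤ J δ) {i j : ℕ}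
    (hi : 1 ≤ i) (hij : i ≤ j) :
    gammaBound C κ R J i δ ≤ ((i : ℝ) / j) ^ (1 - 2 * κ) * gammaBound C κ R J j δ := by
  have hi' : (0 : ℝ) < i := by exact_mod_cast hi
  have hj' : (0 : ℝ) < j := by exact_mod_cast hi.trans hij
  have hu : 0 < (i : ℝ) / j := by positivity
  set u : ℝ := (i : ℝ) / j with hu_def
  have hiu : (i : ℝ) = u * j := by rw [hu_def]; field_simp
  have hu1 : u ≤ 1 := div_le_one_of_le₀ (by exact_mod_cast hij) hj'.le
  have h1 : 1 ≤ u ^ (-κ) := Real.one_le_rpow_of_pos_of_le_one_of_nonpos hu hu1 (by linarith)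
  have h2 : R δ + J δ * (i : ℝ) ^ (-κ) ≤ u ^ (-κ) * (R δ + J δ * (j : ℝ) ^ (-κ)) := by
    rw [hiu, Real.mul_rpow hu.le hj'.le]
    nlinarith [mul_le_mul_of_nonneg_right h1 hR]
  have h3 : u ^ (1 - 2 * κ) = u * (u ^ (-κ)) ^ 2 := by
    rw [← Real.rpow_natCast, ← Real.rpow_mul hu.le]
    nth_rewrite 2 [← Real.rpow_one u]
    rw [← Real.rpow_add hu]
    congr 1
    push_cast
    ring
  calc gammaBound C κ R J i δ
      ≤ C * i * (u ^ (-κ) * (R δ + J δ * (j : ℝ) ^ (-κ))) ^ 2 := by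
        unfold gammaBound
        gcongr
    _ = _ := by
        rw [h3, gammaBound, hiu]
        ring

theorem gammaBound_mono (hC : 0 ≤ C) (hκ : 0 ≤ κ) (hκ' : 2 * κ ≤ 1) (hR : 0 ≤ R δ) (hJ : 0 ≤ J δ)
    {i j : ℕ} (hi : 1 ≤ i) (hij : i ≤ j) :
    gammaBound C κ R J i δ ≤ gammaBound C κ R J j δ := by
  refine (gammaBound_le_rpow_mul hC hκ hR hJ hi hij).trans
    (mul_le_of_le_one_left (gammaBound_nonneg hC j) ?_)
  refine Real.rpow_le_one (by positivity) ?_ (by linarith)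
  exact div_le_one_of_le₀ (by exact_mod_cast hij) (by positivity)

theorem gammaBound_le_mul (hC : 0 ≤ C) (hκ : 0 ≤ κ) (hR : 0 ≤ R δ) (hJ : 0 ≤ J δ) (m : ℕ) :
    gammaBound C κ R J m δ ≤ C * (R δ + J δ) ^ 2 * m := by
  rcases Nat.eq_zero_or_pos m with rfl | hm
  · simp [gammaBound]
  have h1 : (m : ℝ) ^ (-κ) ≤ 1 :=
    Real.rpow_le_one_of_one_le_of_nonpos (by exact_mod_cast hm) (by linarith)
  calc gammaBound C κ R J m δ ≤ C * m * (R δ + J δ * 1) ^ 2 := by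
        unfold gammaBound
        gcongr
    _ = _ := by ring

/-- Midpoint concavity of `x ↦ x ^ a`: the extreme case is `x = y = 1/2`. -/
theorem rpow_add_rpow_le {a x y : ℝ} (ha : 0 ≤ a) (ha1 : a ≤ 1) (hx : 0 ≤ x) (hy : 0 ≤ y)
    (hxy : x + y = 1) : x ^ a + y ^ a ≤ 2 ^ (1 - a) := by
  have h := (Real.concaveOn_rpow ha ha1).2 (Set.mem_Ici.2 hx) (Set.mem_Ici.2 hy)
    (by norm_num : (0 : ℝ) ≤ 1 / 2) (by norm_num : (0 : ℝ) ≤ 1 / 2) (by norm_num)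
  simp only [smul_eq_mul, ← mul_add, hxy, mul_one] at h
  rw [one_div, Real.inv_rpow two_pos.le] at h
  rw [Real.rpow_sub two_pos, Real.rpow_one, div_eq_mul_inv]
  linarith

theorem conditionS_gammaBound {ν : ℝ} (hν : 2 < ν) (hC : 0 ≤ C) (hκ : 0 < κ)
    (hκ' : κ < 1 / 2 - 1 / ν) (hR : 0 ≤ R δ) (hJ : 0 ≤ J δ) :
    ConditionS (ν / 2) (fun m => gammaBound C κ R J m δ) (2 ^ (2 * κ)) := by
  have hν' : 0 < 1 / ν := by positivity
  refine ⟨Real.one_le_rpow one_le_two (by linarith), ?_, fun m _ => gammaBound_nonneg hC m,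
    fun m m' hm hmm => gammaBound_mono hC hκ.le (by linarith) hR hJ hm hmm, fun i j hi hij => ?_⟩
  · refine Real.rpow_lt_rpow_of_exponent_lt one_lt_two ?_
    have : (ν / 2 - 1) / (ν / 2) = 1 - 2 * (1 / ν) := by
      field_simp
    rw [this]
    linarith
  · have hj' : (0 : ℝ) < j := by exact_mod_cast hi.trans hij.le
    have h1 := gammaBound_le_rpow_mul (R := R) (J := J) (δ := δ) hC hκ.le hR hJ hi hij.le
    have h2 := gammaBound_le_rpow_mul (R := R) (J := J) (δ := δ) (i := j - i) hC hκ.le hR hJ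
      (by omega) (Nat.sub_le j i)
    have h3 : ((i : ℝ) / j) ^ (1 - 2 * κ) + (((j - i : ℕ) : ℝ) / j) ^ (1 - 2 * κ) ≤
        2 ^ (2 * κ) := by
      have := rpow_add_rpow_le (a := 1 - 2 * κ) (x := (i : ℝ) / j) (y := ((j - i : ℕ) : ℝ) / j)
        (by linarith) (by linarith) (by positivity) (by positivity) (by
          rw [Nat.cast_sub hij.le]
          field_simp
          ring)
      simpa using this
    calc _ ≤ (((i : ℝ) / j) ^ (1 - 2 * κ) + (((j - i : ℕ) : ℝ) / j) ^ (1 - 2 * κ)) *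
          gammaBound C κ R J j δ := by rw [add_mul]; exact add_le_add h1 h2
      _ ≤ _ := mul_le_mul_of_nonneg_right h3 (gammaBound_nonneg hC j)

theorem tendsto_add_mul_rpow_neg (hκ : 0 < κ) (r s : ℝ) :
    Tendsto (fun n : ℕ => r + s * (n : ℝ) ^ (-κ)) atTop (𝓝 r) := by
  have := ((tendsto_rpow_neg_atTop hκ).comp tendsto_natCast_atTop_atTop).const_mul s
  simpa using tendsto_const_nhds.add this

theorem tendsto_limsup_gammaBound_div (hκ : 0 < κ) (hR0 : Tendsto R (𝓝[>] 0) (𝓝 0)) :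
    Tendsto (fun δ : ℝ =>
      limsup (fun n : ℕ => ((gammaBound C κ R J n δ / (n : ℝ) : ℝ) : EReal)) atTop)
      (𝓝[>] 0) (𝓝 0) := by
  -- The limsup is a limit: `J δ` disappears with `n ^ (-κ)`, however large it is.
  have hlim : ∀ δ, limsup (fun n : ℕ => ((gammaBound C κ R J n δ / (n : ℝ) : ℝ) : EReal)) atTop =
      ((C * R δ ^ 2 : ℝ) : EReal) := by
    intro δ
    refine Tendsto.limsup_eq (continuous_coe_real_ereal.continuousAt.tendsto.comp ?_)
    refine (((tendsto_add_mul_rpow_neg hκ (R δ) (J δ)).pow 2).const_mul C).congr' ?_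
    filter_upwards [eventually_ge_atTop 1] with n hn
    have : (n : ℝ) ≠ 0 := by positivity
    rw [gammaBound]
    field_simp
  simp only [hlim]
  rw [← EReal.coe_zero]
  refine continuous_coe_real_ereal.continuousAt.tendsto.comp ?_
  simpa using (hR0.pow 2).const_mul C

end Gamma

/-! ### Conditions of the functional central limit theorem -/

section Conditions

variable {Ω 𝒳 : Type*} [MeasurableSpace Ω] {P : Measure Ω} {X : ℕ → ℕ → Ω → 𝒳}
  {𝓕 : Set (𝒳 → ℝ)} {ρ : PseudoMetricSpace 𝓕} {ν κ C : ℝ} {R J : ℝ → ℝ}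

theorem supMoment_mono {𝓖 𝓗 : Set (𝒳 → ℝ)} (h : 𝓖 ⊆ 𝓗) (ν : ℝ) (n i j : ℕ) :
    supMoment P X 𝓖 ν n i j ≤ supMoment P X 𝓗 ν n i j :=
  outerExpectation_mono fun _ => biSup_mono fun _ hφ => h hφ

theorem exists_forall_dist_le {S : Type*} [PseudoMetricSpace S]
    (hS : TotallyBounded (Set.univ : Set S)) : ∃ D : ℝ, 0 < D ∧ ∀ f g : S, dist f g ≤ D := by
  obtain ⟨D, hD⟩ := Metric.isBounded_iff.1 hS.isBounded
  exact ⟨max D 1, lt_max_of_lt_right one_pos, fun f g =>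
    (hD (Set.mem_univ f) (Set.mem_univ g)).trans (le_max_left _ _)⟩

theorem exists_subset_diffClass (hρ : @TotallyBounded 𝓕 ρ.toUniformSpace Set.univ)
    (h0 : (0 : 𝒳 → ℝ) ∈ 𝓕) : ∃ D : ℝ, 0 < D ∧ 𝓕 ⊆ diffClass ρ D := by
  obtain ⟨D, hD, hle⟩ := @exists_forall_dist_le 𝓕 ρ hρ
  exact ⟨D, hD, fun f hf => ⟨⟨f, hf⟩, ⟨0, h0⟩, hle _ _, (sub_zero f).symm⟩⟩

theorem uniformFCLTConditions_of_gammaBound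
    (hρ : @TotallyBounded 𝓕 ρ.toUniformSpace Set.univ) (h0 : (0 : 𝒳 → ℝ) ∈ 𝓕) (hν : 2 < ν)
    (hκ : 0 < κ) (hκ' : κ < 1 / 2 - 1 / ν) (hC : 0 ≤ C)
    (hR : ∀ δ, 0 < δ → 0 ≤ R δ) (hJ : ∀ δ, 0 < δ → 0 ≤ J δ) (hR0 : Tendsto R (𝓝[>] 0) (𝓝 0))
    (hbound : ∀ (δ : ℝ) (n i j : ℕ), 0 < δ → 1 ≤ i → i ≤ j → j ≤ n →
      supMoment P X (diffClass ρ δ) ν n i j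
        ≤ ((gammaBound C κ R J (j - i + 1) δ ^ (ν / 2) : ℝ) : EReal)) :
    UniformFCLTConditions P X 𝓕 ρ ν := by
  obtain ⟨D, hD, hsub⟩ := exists_subset_diffClass hρ h0
  refine ⟨⟨gammaBound C κ R J, fun n δ i j hδ hi hij hj => hbound δ n i j hδ hi hij hj,
    ⟨2 ^ (2 * κ), fun δ hδ => conditionS_gammaBound hν hC hκ hκ' (hR δ hδ) (hJ δ hδ)⟩,
    tendsto_limsup_gammaBound_div hκ hR0⟩,
    fun m => gammaBound C κ R J m D, by simp [gammaBound],
    fun n i j hi hij hj => (supMoment_mono hsub ν n i j).trans (hbound D n i j hD hi hij hj),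
    ⟨2 ^ (2 * κ), conditionS_gammaBound hν hC hκ hκ' (hR D hD) (hJ D hD)⟩,
    C * (R D + J D) ^ 2, by positivity, fun ε hε _ => ?_⟩
  refine limsup_le_of_le (by isBoundedDefault) (Eventually.of_forall fun n => ?_)
  rw [EReal.coe_le_coe_iff]
  rcases Nat.eq_zero_or_pos n with rfl | hn
  · simpa using by positivity
  rw [div_le_iff₀ (by exact_mod_cast hn)]
  have h1 := gammaBound_le_mul (R := R) (J := J) hC hκ.le (hR D hD) (hJ D hD) ⌊(n : ℝ) * ε⌋₊
  have h2 : ((⌊(n : ℝ) * ε⌋₊ : ℕ) : ℝ) ≤ n * ε := Nat.floor_le (by positivity)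
  calc _ ≤ C * (R D + J D) ^ 2 * (⌊(n : ℝ) * ε⌋₊ : ℕ) := h1
    _ ≤ C * (R D + J D) ^ 2 * (n * ε) := by gcongr
    _ = _ := by ring

end Conditions

/-! ### Asymptotic equicontinuity -/

section Equicontinuity

variable {Ω 𝒳 : Type*} [MeasurableSpace Ω] {P : Measure Ω} {X : ℕ → ℕ → Ω → 𝒳}

/-- Increments of the partial sums over short time intervals, uniformly over a class. -/
theorem measure_exists_increment_le {𝓖 : Set (𝒳 → ℝ)} (hne : 𝓖.Nonempty) {a ν A : ℝ}
    (hν : 1 ≤ ν) (ha : 2 / ν < a) {Γ : ℕ → ℝ} (hΓ0 : ∀ m, 0 ≤ Γ m)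
    (hΓ : ∀ i j, 1 ≤ i → i ≤ j → Γ i ≤ ((i : ℝ) / j) ^ a * Γ j) (hA : 0 ≤ A)
    (hΓA : ∀ m, Γ m ≤ A * m) {n : ℕ}
    (hmom : ∀ i j, 1 ≤ i → i ≤ j → j ≤ n →
      supMoment P X 𝓖 ν n i j ≤ ((Γ (j - i + 1) ^ (ν / 2) : ℝ) : EReal))
    {x δ : ℝ} (hx : 0 < x) (hδ : 0 < δ) (hδ1 : δ ≤ 1) (hnδ : 1 ≤ n * δ) :
    P {ω | ∃ φ ∈ 𝓖, ∃ b c : ℕ, b ≤ c ∧ c ≤ n ∧ (c : ℝ) ≤ b + (n * δ + 1) ∧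
        x ≤ |partialSum P X n 1 c φ ω - partialSum P X n 1 b φ ω|} ≤
      ENNReal.ofReal (2 / δ * (maxConst a ν * √(8 * A * (n * δ)) / (x / 2)) ^ ν) := by
  have hK0 : 0 ≤ maxConst a ν := zero_le_one.trans (one_le_maxConst a ν)
  have hn0 : (0 : ℝ) < n := by
    by_contra h
    have : (n : ℝ) * δ ≤ 0 := mul_nonpos_of_nonpos_of_nonneg (not_lt.1 h) hδ.le
    linarith
  obtain ⟨q, hq1, hq2⟩ := exists_nat_pow_near (by linarith : 1 ≤ (n : ℝ) * δ + 1) one_lt_two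
  set N : ℕ := 2 ^ (q + 1) with hN
  have hNpos : 0 < N := by positivity
  have hNle : (N : ℝ) ≤ 4 * (n * δ) := by
    rw [hN]; push_cast; rw [pow_succ]; linarith
  have hNge : (n : ℝ) * δ + 1 < N := by
    rw [hN]; push_cast; exact hq2
  -- The blocks start at multiples of `N` but have length `2N`, so a window of length at most `N`
  -- lies in the block where it begins. One of its endpoints is then at least `x / 2` away from the
  -- value at the block's start.
  set B : ℕ → Set Ω := fun l => {ω | ∃ φ ∈ 𝓖, ∃ k ≤ 2 ^ (q + 2), x / 2 ≤
        |partialSum P X n 1 (min (l * N + k) n) φ ω - partialSum P X n 1 (min (l * N) n) φ ω|}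
    with hB
  have hBle : ∀ l, P (B l) ≤
      ENNReal.ofReal ((maxConst a ν * √(8 * A * (n * δ)) / (x / 2)) ^ ν) := by
    intro l
    refine (measure_exists_le_abs_partialSum_le hne hν ha hΓ0 hΓ hmom (q + 2) (l * N)
      (half_pos hx)).trans (ENNReal.ofReal_le_ofReal ?_)
    have h8 : Γ (2 ^ (q + 2)) ≤ 8 * A * (n * δ) := by
      refine (hΓA _).trans ?_
      have e : ((2 ^ (q + 2) : ℕ) : ℝ) = 2 * N := by rw [hN]; push_cast; ring
      rw [e]
      nlinarith [mul_le_mul_of_nonneg_left hNle hA]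
    have hν0 : 0 ≤ ν := by linarith
    gcongr
  have hsub : {ω | ∃ φ ∈ 𝓖, ∃ b c : ℕ, b ≤ c ∧ c ≤ n ∧ (c : ℝ) ≤ b + (n * δ + 1) ∧
        x ≤ |partialSum P X n 1 c φ ω - partialSum P X n 1 b φ ω|} ⊆
      ⋃ l ∈ Finset.range (n / N + 1), B l := by
    rintro ω ⟨φ, hφ, b, c, hbc, hcn, hcb, hxle⟩
    have hcN : c ≤ b + N := by
      have : (c : ℝ) ≤ ((b + N : ℕ) : ℝ) := by push_cast; linarith
      exact_mod_cast this
    have hl : b / N < n / N + 1 := Nat.lt_succ_of_le (Nat.div_le_div_right (hbc.trans hcn))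
    refine Set.mem_biUnion (Finset.mem_coe.2 (Finset.mem_range.2 hl)) ?_
    have hdiv := Nat.div_add_mod' b N
    have hmod := Nat.mod_lt b hNpos
    set l := b / N
    have hpow : 2 ^ (q + 2) = 2 * N := by rw [hN]; ring
    have key : x / 2 ≤ |partialSum P X n 1 c φ ω - partialSum P X n 1 (l * N) φ ω| ∨
        x / 2 ≤ |partialSum P X n 1 b φ ω - partialSum P X n 1 (l * N) φ ω| := by
      by_contra! h
      have := abs_sub_le (partialSum P X n 1 c φ ω) (partialSum P X n 1 (l * N) φ ω)
        (partialSum P X n 1 b φ ω)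
      rw [abs_sub_comm (partialSum P X n 1 (l * N) φ ω)] at this
      linarith [h.1, h.2]
    have hlb : l * N ≤ b := by omega
    have hln : min (l * N) n = l * N := min_eq_left (hlb.trans (hbc.trans hcn))
    rcases key with h | h
    · refine ⟨φ, hφ, c - l * N, by rw [hpow]; omega, ?_⟩
      rwa [hln, Nat.add_sub_cancel' (hlb.trans hbc), min_eq_left hcn]
    · refine ⟨φ, hφ, b - l * N, by rw [hpow]; omega, ?_⟩
      rwa [hln, Nat.add_sub_cancel' hlb, min_eq_left (hbc.trans hcn)]
  have hcount : ((n / N + 1 : ℕ) : ℝ) ≤ 2 / δ := by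
    have h1 : ((n / N : ℕ) : ℝ) ≤ n / N := Nat.cast_div_le
    have h2 : (n : ℝ) / N ≤ 1 / δ := by
      rw [div_le_div_iff₀ (by exact_mod_cast hNpos) hδ]
      linarith
    have h3 : 1 ≤ 1 / δ := by rw [le_div_iff₀ hδ]; linarith
    have h4 : 2 / δ = 1 / δ + 1 / δ := by ring
    push_cast
    linarith
  calc _ ≤ ∑ l ∈ Finset.range (n / N + 1), P (B l) :=
        (measure_mono hsub).trans (measure_biUnion_finset_le _ _)
    _ ≤ ∑ _l ∈ Finset.range (n / N + 1),
          ENNReal.ofReal ((maxConst a ν * √(8 * A * (n * δ)) / (x / 2)) ^ ν) :=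
        Finset.sum_le_sum fun l _ => hBle l
    _ = ENNReal.ofReal ((n / N + 1 : ℕ) *
          (maxConst a ν * √(8 * A * (n * δ)) / (x / 2)) ^ ν) := by
        rw [Finset.sum_const, Finset.card_range, nsmul_eq_mul,
          ENNReal.ofReal_mul (Nat.cast_nonneg _), ENNReal.ofReal_natCast]
    _ ≤ _ := by
        refine ENNReal.ofReal_le_ofReal (mul_le_mul_of_nonneg_right hcount ?_)
        positivity

/-- Partial sums over a class of functions, uniformly in time. -/
theorem measure_exists_partialSum_le {𝓖 : Set (𝒳 → ℝ)} (hne : 𝓖.Nonempty) {κ ν C δ : ℝ}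
    {R J : ℝ → ℝ} (hν : 2 < ν) (hκ : 0 < κ) (hκ' : κ < 1 / 2 - 1 / ν) (hC : 0 ≤ C)
    (hR : 0 ≤ R δ) (hJ : 0 ≤ J δ) {n : ℕ} (hn : 1 ≤ n)
    (hmom : ∀ i j, 1 ≤ i → i ≤ j → j ≤ n →
      supMoment P X 𝓖 ν n i j ≤ ((gammaBound C κ R J (j - i + 1) δ ^ (ν / 2) : ℝ) : EReal))
    {x : ℝ} (hx : 0 < x) :
    P {ω | ∃ φ ∈ 𝓖, ∃ k ≤ n, x ≤ |partialSum P X n 1 k φ ω|} ≤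
      ENNReal.ofReal ((maxConst (1 - 2 * κ) ν *
        (√(2 * C) * √n * (R δ + J δ * (n : ℝ) ^ (-κ))) / x) ^ ν) := by
  have hn0 : (0 : ℝ) < n := by exact_mod_cast hn
  have hν1 : 2 / ν = 2 * (1 / ν) := by ring
  have hν0 : 0 < 1 / ν := by positivity
  have hK0 : 0 ≤ maxConst (1 - 2 * κ) ν := zero_le_one.trans (one_le_maxConst _ ν)
  -- Here `n < 2 ^ (q + 1) ≤ 2n`; rounding up to a power of two turns `C` into `2 * C`.
  obtain ⟨q, hq1, hq2⟩ := exists_nat_pow_near hn one_lt_two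
  have hmain := measure_exists_le_abs_partialSum_le (P := P) (X := X) hne (by linarith)
    (by linarith : 2 / ν < 1 - 2 * κ) (fun m => gammaBound_nonneg hC m)
    (fun i j hi hij => gammaBound_le_rpow_mul (R := R) (J := J) (δ := δ) hC hκ.le hR hJ hi hij)
    hmom (q + 1) 0 hx
  refine (measure_mono ?_).trans (hmain.trans (ENNReal.ofReal_le_ofReal ?_))
  · rintro ω ⟨φ, hφ, k, hk, hxk⟩
    refine ⟨φ, hφ, k, hk.trans hq2.le, ?_⟩
    have hz : partialSum P X n 1 0 φ ω = 0 := by simp [partialSum]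
    rwa [Nat.zero_min, hz, sub_zero, Nat.zero_add, min_eq_left hk]
  · have h1 : gammaBound C κ R J (2 ^ (q + 1)) δ ≤ gammaBound C κ R J (2 * n) δ :=
      gammaBound_mono hC hκ.le (by linarith) hR hJ Nat.one_le_two_pow (by rw [pow_succ]; omega)
    have h2 : ((2 * n : ℕ) : ℝ) ^ (-κ) ≤ (n : ℝ) ^ (-κ) :=
      Real.rpow_le_rpow_of_nonpos hn0 (by push_cast; linarith) (by linarith)
    have h3 : √(gammaBound C κ R J (2 ^ (q + 1)) δ) ≤
        √(2 * C) * √n * (R δ + J δ * (n : ℝ) ^ (-κ)) := by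
      calc _ ≤ √(2 * C * n * (R δ + J δ * (n : ℝ) ^ (-κ)) ^ 2) := by
            refine Real.sqrt_le_sqrt (h1.trans ?_)
            calc gammaBound C κ R J (2 * n) δ
                = 2 * C * n * (R δ + J δ * ((2 * n : ℕ) : ℝ) ^ (-κ)) ^ 2 := by
                  rw [gammaBound]; push_cast; ring
              _ ≤ _ := by gcongr
        _ = _ := by
            rw [Real.sqrt_mul (by positivity), Real.sqrt_sq (by positivity),
              Real.sqrt_mul (by positivity)]
    have hν2 : 0 ≤ ν := by linarith
    gcongr

variable [MeasurableSpace 𝒳] {𝓕 : Set (𝒳 → ℝ)}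

theorem Framework.integrable (hF : Framework P X 𝓕) {f : 𝒳 → ℝ} (hf : f ∈ 𝓕) {n i : ℕ}
    (hi : 1 ≤ i) (hin : i ≤ n) : Integrable (fun ω => f (X n i ω)) P := by
  obtain ⟨F, -, hFb, hFi⟩ := hF.envelope
  exact (hFi n i hi hin).mono'
    ((hF.measurable_class f hf).comp (hF.measurable_array n i hi hin)).aestronglyMeasurable
    (Eventually.of_forall fun ω => hFb f hf _)

theorem Framework.partialSum_sub (hF : Framework P X 𝓕) {f g : 𝒳 → ℝ} (hf : f ∈ 𝓕) (hg : g ∈ 𝓕)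
    {n j : ℕ} (hj : j ≤ n) (ω : Ω) :
    partialSum P X n 1 j (f - g) ω = partialSum P X n 1 j f ω - partialSum P X n 1 j g ω := by
  rw [partialSum, partialSum, partialSum, ← Finset.sum_sub_distrib]
  refine Finset.sum_congr rfl fun k hk => ?_
  rw [Finset.mem_Icc] at hk
  have := integral_sub (hF.integrable hf hk.1 (hk.2.trans hj))
    (hF.integrable hg hk.1 (hk.2.trans hj))
  simp only [centered, Pi.sub_apply, this]
  ring

theorem floor_natCast_mul_le (n : ℕ) (t : Set.Icc (0 : ℝ) 1) : ⌊(n : ℝ) * t⌋₊ ≤ n :=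
  Nat.floor_le_of_le (mul_le_of_le_one_right (Nat.cast_nonneg n) t.2.2)

/-- Large increments of the sequential empirical process are due to large partial sums over the
class of differences or to large increments in time. -/
theorem Framework.subset_union_of_increment (hF : Framework P X 𝓕) (ρ : PseudoMetricSpace 𝓕)
    {n : ℕ} (hn : 1 ≤ n) {ε δ : ℝ} :
    {ω | (ε : EReal) < ⨆ (p : Idx 𝓕) (q : Idx 𝓕) (_ : tau ρ p q ≤ δ),
        ((|seqEmp P X n p.1 p.2 ω - seqEmp P X n q.1 q.2 ω| : ℝ) : EReal)} ⊆
      {ω | ∃ φ ∈ diffClass ρ δ, ∃ k ≤ n, ε * √n / 2 ≤ |partialSum P X n 1 k φ ω|} ∪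
      {ω | ∃ φ ∈ 𝓕, ∃ b c : ℕ, b ≤ c ∧ c ≤ n ∧ (c : ℝ) ≤ b + (n * δ + 1) ∧
        ε * √n / 2 ≤ |partialSum P X n 1 c φ ω - partialSum P X n 1 b φ ω|} := by
  intro ω hω
  simp only [Set.mem_ofPred_eq, lt_iSup_iff] at hω
  obtain ⟨⟨s, f⟩, ⟨t, g⟩, hτ, hlt⟩ := hω
  simp only [tau] at hτ
  have hlt : ε < |seqEmp P X n s f ω - seqEmp P X n t g ω| := by exact_mod_cast hlt
  have hst : |(s : ℝ) - t| ≤ δ := by linarith [@dist_nonneg 𝓕 ρ f g]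
  have hfg : ρ.dist f g ≤ δ := by linarith [abs_nonneg ((s : ℝ) - t)]
  have hsqrt : 0 < √(n : ℝ) := Real.sqrt_pos.2 (by exact_mod_cast hn)
  set a := ⌊(n : ℝ) * s⌋₊ with ha
  set b := ⌊(n : ℝ) * t⌋₊ with hb
  have han : a ≤ n := floor_natCast_mul_le n s
  have hbn : b ≤ n := floor_natCast_mul_le n t
  have hlt' : ε * √n < |partialSum P X n 1 a (f - g : 𝒳 → ℝ) ω| +
      |partialSum P X n 1 a g ω - partialSum P X n 1 b g ω| := by
    have e : seqEmp P X n s f ω - seqEmp P X n t g ω =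
        (partialSum P X n 1 a f ω - partialSum P X n 1 b g ω) / √n := by
      simp only [seqEmp, ← ha, ← hb]
      ring
    rw [e, abs_div, abs_of_pos hsqrt, lt_div_iff₀ hsqrt] at hlt
    rw [hF.partialSum_sub f.2 g.2 han]
    exact hlt.trans_le (abs_sub_le _ _ _)
  rcases le_or_gt (ε * √n / 2) |partialSum P X n 1 a (f - g : 𝒳 → ℝ) ω| with h | h
  · exact Or.inl ⟨_, ⟨f, g, hfg, rfl⟩, a, han, h⟩
  · have h2 : ε * √n / 2 ≤ |partialSum P X n 1 a g ω - partialSum P X n 1 b g ω| := by linarith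
    -- Rounding to integer times lengthens a window by at most one, hence `n * δ + 1`.
    have hfloor : ∀ u v : Set.Icc (0 : ℝ) 1, (v : ℝ) - u ≤ δ →
        ((⌊(n : ℝ) * v⌋₊ : ℕ) : ℝ) ≤ (⌊(n : ℝ) * u⌋₊ : ℕ) + (n * δ + 1) := by
      intro u v huv
      have h1 : ((⌊(n : ℝ) * v⌋₊ : ℕ) : ℝ) ≤ n * v :=
        Nat.floor_le (mul_nonneg (Nat.cast_nonneg n) v.2.1)
      have h2 := Nat.lt_floor_add_one ((n : ℝ) * u)
      have h3 := mul_le_mul_of_nonneg_left huv (Nat.cast_nonneg (α := ℝ) n)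
      linarith
    refine Or.inr ⟨g, g.2, ?_⟩
    rcases le_total (s : ℝ) t with hle | hle
    · refine ⟨a, b, ?_, hbn, hfloor s t (by linarith [(abs_le.1 hst).1]), by rwa [abs_sub_comm]⟩
      exact Nat.floor_le_floor (mul_le_mul_of_nonneg_left hle (Nat.cast_nonneg n))
    · refine ⟨b, a, ?_, han, hfloor t s (by linarith [(abs_le.1 hst).2]), h2⟩
      exact Nat.floor_le_floor (mul_le_mul_of_nonneg_left hle (Nat.cast_nonneg n))

theorem Framework.aec_of_gammaBound (hF : Framework P X 𝓕) {ρ : PseudoMetricSpace 𝓕}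
    (hρ : @TotallyBounded 𝓕 ρ.toUniformSpace Set.univ) (h0 : (0 : 𝒳 → ℝ) ∈ 𝓕)
    {ν κ C : ℝ} (hν : 2 < ν) (hκ : 0 < κ) (hκ' : κ < 1 / 2 - 1 / ν) (hC : 0 ≤ C)
    {R J : ℝ → ℝ} (hR : ∀ δ, 0 < δ → 0 ≤ R δ) (hJ : ∀ δ, 0 < δ → 0 ≤ J δ)
    (hR0 : Tendsto R (𝓝[>] 0) (𝓝 0))
    (hbound : ∀ (δ : ℝ) (n i j : ℕ), 0 < δ → 1 ≤ i → i ≤ j → j ≤ n →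
      supMoment P X (diffClass ρ δ) ν n i j
        ≤ ((gammaBound C κ R J (j - i + 1) δ ^ (ν / 2) : ℝ) : EReal)) :
    AEC P X (tau ρ) := by
  intro ε hε
  obtain ⟨D, hD, hsub⟩ := exists_subset_diffClass hρ h0
  have hν0 : 0 < ν := by linarith
  have hν1 : 2 / ν = 2 * (1 / ν) := by ring
  set K := maxConst (1 - 2 * κ) ν
  set A := C * (R D + J D) ^ 2
  have hA : 0 ≤ A := by positivity
  have hK0 : 0 ≤ K := zero_le_one.trans (one_le_maxConst _ ν)
  -- Both constants come from the threshold `ε * √n / 2`: its `√n` cancels the one in the moment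
  -- bounds. In `c₂` the threshold is halved again and the leading `2` comes from the block count `2
  -- / δ`.
  set c₁ := 2 * K * √(2 * C) / ε
  set c₂ := 2 * (4 * K * √(8 * A) / ε) ^ ν
  have hne : 𝓕.Nonempty := ⟨0, h0⟩
  have hbd : ∀ δ : ℝ, 0 < δ → δ ≤ 1 → ∀ᶠ n : ℕ in atTop,
      P {ω | (ε : EReal) < ⨆ (p : Idx 𝓕) (q : Idx 𝓕) (_ : tau ρ p q ≤ δ),
          ((|seqEmp P X n p.1 p.2 ω - seqEmp P X n q.1 q.2 ω| : ℝ) : EReal)} ≤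
        ENNReal.ofReal ((c₁ * (R δ + J δ * (n : ℝ) ^ (-κ))) ^ ν) +
          ENNReal.ofReal (c₂ * δ ^ (ν / 2 - 1)) := by
    intro δ hδ hδ1
    filter_upwards [eventually_ge_atTop 1,
      tendsto_natCast_atTop_atTop.eventually_ge_atTop (1 / δ)] with n hn hnδ
    rw [div_le_iff₀ hδ] at hnδ
    have hn0 : (0 : ℝ) < n := by exact_mod_cast hn
    have hsqrt : 0 < √(n : ℝ) := Real.sqrt_pos.2 hn0
    have hx : 0 < ε * √n / 2 := by positivity
    refine (measure_mono (hF.subset_union_of_increment ρ hn)).trans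
      ((measure_union_le _ _).trans (add_le_add ?_ ?_))
    · have hned : (diffClass ρ δ).Nonempty :=
        ⟨_, ⟨0, h0⟩, ⟨0, h0⟩, (@dist_self 𝓕 ρ _).trans_le hδ.le, rfl⟩
      refine (measure_exists_partialSum_le hned hν hκ hκ' hC (hR δ hδ) (hJ δ hδ) hn
        (fun i j hi hij hj => hbound δ n i j hδ hi hij hj) hx).trans_eq ?_
      congr 2
      simp only [c₁, K]
      field_simp
    · refine (measure_exists_increment_le hne (by linarith) (by linarith : 2 / ν < 1 - 2 * κ)
        (fun m => gammaBound_nonneg (κ := κ) (R := R) (J := J) (δ := D) hC m)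
        (fun i j hi hij => gammaBound_le_rpow_mul hC hκ.le (hR D hD) (hJ D hD) hi hij) hA
        (fun m => gammaBound_le_mul hC hκ.le (hR D hD) (hJ D hD) m)
        (fun i j hi hij hj => (supMoment_mono hsub ν n i j).trans (hbound D n i j hD hi hij hj))
        hx hδ hδ1 hnδ).trans_eq ?_
      congr 1
      have e1 : maxConst (1 - 2 * κ) ν * √(8 * A * (n * δ)) / (ε * √n / 2 / 2) =
          4 * K * √(8 * A) / ε * √δ := by
        rw [Real.sqrt_mul (by positivity), Real.sqrt_mul hn0.le]
        field_simp
        ring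
      rw [e1, Real.mul_rpow (by positivity) (Real.sqrt_nonneg δ), Real.sqrt_eq_rpow δ,
        ← Real.rpow_mul hδ.le, Real.rpow_sub_one hδ.ne']
      simp only [c₂]
      have : 1 / 2 * ν = ν / 2 := by ring
      rw [this]
      ring
  have hlimsup : ∀ᶠ δ : ℝ in 𝓝[>] 0, limsup (fun n : ℕ =>
      P {ω | (ε : EReal) < ⨆ (p : Idx 𝓕) (q : Idx 𝓕) (_ : tau ρ p q ≤ δ),
        ((|seqEmp P X n p.1 p.2 ω - seqEmp P X n q.1 q.2 ω| : ℝ) : EReal)}) atTop ≤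
      ENNReal.ofReal ((c₁ * R δ) ^ ν) + ENNReal.ofReal (c₂ * δ ^ (ν / 2 - 1)) := by
    filter_upwards [Ioc_mem_nhdsGT one_pos] with δ hδ
    refine (limsup_le_limsup (hbd δ hδ.1 hδ.2)).trans_eq (Tendsto.limsup_eq ?_)
    refine Tendsto.add_const _ ?_
    exact ENNReal.tendsto_ofReal (((tendsto_add_mul_rpow_neg hκ (R δ) (J δ)).const_mul
      c₁).rpow_const (Or.inr hν0.le))
  refine tendsto_of_tendsto_of_tendsto_of_le_of_le' tendsto_const_nhds ?_
    (Eventually.of_forall fun _ => zero_le) hlimsup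
  have t1 : Tendsto (fun δ => (c₁ * R δ) ^ ν) (𝓝[>] 0) (𝓝 0) := by
    have := (hR0.const_mul c₁).rpow_const (p := ν) (Or.inr hν0.le)
    simpa [Real.zero_rpow hν0.ne'] using this
  have t2 : Tendsto (fun δ : ℝ => c₂ * δ ^ (ν / 2 - 1)) (𝓝[>] 0) (𝓝 0) := by
    have hid : Tendsto (fun δ : ℝ => δ) (𝓝[>] 0) (𝓝 0) := nhdsWithin_le_nhds
    have := (hid.rpow_const (p := ν / 2 - 1) (Or.inr (by linarith))).const_mul c₂
    simpa [Real.zero_rpow (by linarith : ν / 2 - 1 ≠ 0)] using this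
  simpa using (ENNReal.tendsto_ofReal t1).add (ENNReal.tendsto_ofReal t2)

end Equicontinuity

/-! ### From asymptotic equicontinuity to finite approximability. -/

section EmpiricalMaps

theorem exists_fin_net {S : Type*} [PseudoMetricSpace S] (hS : TotallyBounded (Set.univ : Set S))
    {δ : ℝ} (hδ : 0 < δ) :
    ∃ (k : ℕ) (ψ : Fin k → S) (π : S → Fin k), ∀ t, dist t (ψ (π t)) ≤ δ := by
  obtain ⟨s, hs, hcov⟩ := Metric.totallyBounded_iff.1 hS δ hδ
  have := hs.fintype
  have h : ∀ t : S, ∃ y : s, dist t y < δ := fun t => by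
    obtain ⟨y, hy, hty⟩ := Set.mem_iUnion₂.1 (hcov (Set.mem_univ t))
    exact ⟨⟨y, hy⟩, hty⟩
  choose y hy using h
  exact ⟨Fintype.card s, fun l => ((Fintype.equivFin s).symm l : S),
    fun t => Fintype.equivFin s (y t), fun t => by simpa using (hy t).le⟩

theorem exists_fin_net_tau {𝒳 : Type*} {𝓕 : Set (𝒳 → ℝ)} {ρ : PseudoMetricSpace 𝓕}
    (hρ : @TotallyBounded 𝓕 ρ.toUniformSpace Set.univ) {δ : ℝ} (hδ : 0 < δ) :
    ∃ (k : ℕ) (ψ : Fin k → Idx 𝓕) (π : Idx 𝓕 → Fin k), ∀ t, tau ρ t (ψ (π t)) ≤ δ := by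
  obtain ⟨k₁, ψ₁, π₁, h₁⟩ := exists_fin_net (S := Set.Icc (0 : ℝ) 1)
    isCompact_univ.totallyBounded (half_pos hδ)
  obtain ⟨k₂, ψ₂, π₂, h₂⟩ := @exists_fin_net 𝓕 ρ hρ _ (half_pos hδ)
  refine ⟨k₁ * k₂, fun l => (ψ₁ (finProdFinEquiv.symm l).1, ψ₂ (finProdFinEquiv.symm l).2),
    fun t => finProdFinEquiv (π₁ t.1, π₂ t.2), fun t => ?_⟩
  simp only [tau, Equiv.symm_apply_apply]
  have e₁ := h₁ t.1
  rw [Subtype.dist_eq, Real.dist_eq] at e₁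
  have e₂ := h₂ t.2
  linarith

variable {Ω 𝒳 : Type*} [MeasurableSpace Ω] [MeasurableSpace 𝒳] {P : Measure Ω}
  {X : ℕ → ℕ → Ω → 𝒳} {𝓕 : Set (𝒳 → ℝ)}

theorem measurable_seqEmpLinf_apply (hF : Framework P X 𝓕) (n : ℕ) (t : Idx 𝓕) :
    Measurable fun ω => seqEmpLinf hF n ω t := by
  change Measurable fun ω => seqEmp P X n t.1 t.2 ω
  refine measurable_const.mul (Finset.measurable_sum _ fun k hk => ?_)
  rw [Finset.mem_Icc] at hk
  exact ((hF.measurable_class _ t.2.2).comp (hF.measurable_array n k hk.1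
    (hk.2.trans (floor_natCast_mul_le n t.1)))).sub_const _

/-- Asymptotic equicontinuity and total boundedness yield finite approximability. -/
theorem AEC.finitelyApproximable (hF : Framework P X 𝓕) {ρ : PseudoMetricSpace 𝓕}
    (hρ : @TotallyBounded 𝓕 ρ.toUniformSpace Set.univ) (h : AEC P X (tau ρ)) :
    FinitelyApproximable P (seqEmpLinf hF) := by
  intro ε hε
  -- One `δ` is fixed with limsup below `ε`; moving each index to its point in a finite `δ`-net for
  -- `tau` is then an increment already controlled.
  obtain ⟨δ, hδlim, hδ⟩ := (((h ε hε).eventually_lt_const (ENNReal.ofReal_pos.2 hε)).and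
    self_mem_nhdsWithin).exists
  obtain ⟨k, ψ, π, hψ⟩ := exists_fin_net_tau hρ hδ
  refine ⟨k, ψ, π, ?_⟩
  filter_upwards [eventually_lt_of_limsup_lt hδlim] with n hn
  refine (measure_mono ?_).trans hn.le
  rintro ω ⟨t, ht⟩
  simp only [Set.mem_ofPred_eq, lt_iSup_iff]
  exact ⟨t, ψ (π t), hψ t, EReal.coe_lt_coe_iff.2 ht⟩

end EmpiricalMaps

end SeqEmp

end

theorem corollary2p4 {Ω 𝒳 : Type*} [MeasurableSpace Ω] [MeasurableSpace 𝒳]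
    (P : Measure Ω) [IsProbabilityMeasure P] (X : ℕ → ℕ → Ω → 𝒳) (𝓕 : Set (𝒳 → ℝ))
    (hF : SeqEmp.Framework P X 𝓕)
    (ρ : PseudoMetricSpace 𝓕) (hρ : @TotallyBounded 𝓕 ρ.toUniformSpace Set.univ)
    (h0 : (0 : 𝒳 → ℝ) ∈ 𝓕)
    (ν κ C : ℝ) (hν : 2 < ν) (hκ : 0 < κ) (hκ' : κ < 1 / 2 - 1 / ν) (hC : 0 ≤ C)
    (R J : ℝ → ℝ) (hR : ∀ δ, 0 < δ → 0 ≤ R δ) (hJ : ∀ δ, 0 < δ → 0 ≤ J δ)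
    (hR0 : Tendsto R (𝓝[>] 0) (𝓝 0))
    (hbound : ∀ (δ : ℝ) (n i j : ℕ), 0 < δ → 1 ≤ i → i ≤ j → j ≤ n →
      SeqEmp.supMoment P X (SeqEmp.diffClass ρ δ) ν n i j
        ≤ ((SeqEmp.gammaBound C κ R J (j - i + 1) δ ^ (ν / 2) : ℝ) : EReal)) :
    SeqEmp.UniformFCLTConditions P X 𝓕 ρ ν ∧
    SeqEmp.AEC P X (SeqEmp.tau ρ) ∧
    (∀ (Ω' : Type*) [MeasurableSpace Ω'] (P' : Measure Ω') [IsProbabilityMeasure P']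
      (Z : Ω' → SeqEmp.Linf (SeqEmp.Idx 𝓕)), SeqEmp.IsTightRandomElement P' Z →
      SeqEmp.FidiConv P (SeqEmp.seqEmpLinf hF) P' Z →
      SeqEmp.WeakConv P (SeqEmp.seqEmpLinf hF) P' Z) ∧
    (SeqEmp.FidiConvergent P (SeqEmp.seqEmpLinf hF) →
      ∃ L : Measure (SeqEmp.Linf (SeqEmp.Idx 𝓕)), IsProbabilityMeasure L ∧
        IsTightMeasureSet {L} ∧ SeqEmp.WeakConv P (SeqEmp.seqEmpLinf hF) L id) := by
  have hAEC := hF.aec_of_gammaBound hρ h0 hν hκ hκ' hC hR hJ hR0 hbound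
  have hap := hAEC.finitelyApproximable hF hρ
  have hm := SeqEmp.measurable_seqEmpLinf_apply hF
  exact ⟨SeqEmp.uniformFCLTConditions_of_gammaBound hρ h0 hν hκ hκ' hC hR hJ hR0 hbound, hAEC,
    fun _ _ _ _ _ hZ hfidi => hap.weakConv hm hZ hfidi, hap.exists_weakConv hm⟩
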